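/- Let $G$ be a finite group, $r\ge 0$, and let $K_0=K_0((G,r)\text{-sets})$ be the Grothendieck ring (sum: disjoint union, product: Cartesian product) of locally finite $(G,r)$-sets, i.e. of triples $A=(X,w,\alpha)$ where $X$ is a $G$-set, $w:X\to\mathbb Z_{\ge0}^r$ is a function such that $\{x: w(x)\le W\}$ is finite for every $W$, and $\alpha$ assigns to $x\in X$ a one-dimensional representation $\alpha_x$ of the isotropy group $G_x$ with $\alpha_{ax}=a\alpha_xa^{-1}$ (on a product, $w$ is added and $\alpha$ is multiplied). Let $K_0'$ and $K_0''$ be the subrings (the second without unit) generated by the classes of the $(G,r)$-sets with trivial action and of those without fixed points, and let $R_1(G)$ be the subring of the ring of complex representations generated by the one-dimensional ones. Infinite sums in $K_0$ are taken modulo the subgroups generated by sets having no point $x$ with $w(x)\le W$; in $R_1(G)[[t_1,\dots,t_r]]$, coefficientwise. Let $(V,0)$ be a germ of a complex analytic variety with an action of $G$, $\mathcal O=\mathcal O_{V,0}$ with $(a^*f)(x)=f(a^{-1}x)$ and maximal ideal $\mathfrak m$, and let $v_1,\dots,v_r:\mathcal O\to\mathbb Z_{\ge0}\cup\{+\infty\}$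 be order functions ($v_i(\lambda f)=v_i(f)$ for $\lambda\in\mathbb C^*$, $v_i(f+g)\ge\min(v_i(f),v_i(g))$) whose filtration $J(w)=\{f: v_i(f)\ge w_i\ \forall i\}$ is finitely determined: every $J(w)$ contains a power of $\mathfrak m$. Let $v=(v_1,\dots,v_r)$. For $f\in\mathbb P\mathcal O$ let $G_f$ be its isotropy group and $\lambda_f$ the representation of $G_f$ with $a^*f=\lambda_f(a)f$. Let $T_f\in K_0$ be the class of the orbit $Gf$ with $w=v$ and $\alpha=\lambda$ (and $T_f=0$ if some $v_i$ takes the value $+\infty$ on the orbit). The equivariant Poincaré series is $$P^G_{\{v_i\}}=\int_{\mathbb P\mathcal O/G}T_f\,d\chi=\sum_{a\in K_0,\,a\ne0}\chi(T^{-1}(a))\,a\ \in K_0 .$$ Here, with $\pi_k$ the map to $k$-jets ($J^k=\mathcal O/\mathfrak m^{k+1}$), a set $B\subset\mathbb P\mathcal O/G$ is cylindric with $\chi(B)=c$ if for all large $k$ it contains no $f$ with zero $k$-jet and there is a constructible $Z\subset\mathbb PJ^k/G$ with $\chi(Z)=c$ such that $B$ and $\pi_k^{-1}(Z)$ contain the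 same points $f$ among those whose isotropy group is equal to that of the $k$-jet of $f$. The earlier equivariant Poincaré series is $$P^G_{\{v_i\}}(t_1,\dots,t_r)=\int\lambda_f\,t^{v(f)}\,d\chi\ \in R_1(G)[[t_1,\dots,t_r]],\qquad t^{+\infty}=0,$$ the integral being over the projectivization of the union over all one-dimensional representations $\alpha$ of $G$ of the spaces $\{f: a^*f=\alpha(a)f\ \forall a\in G\}$, where cylindric sets are the preimages of constructible sets of (projectivized) jets of such functions. **Statement.** The series $P^G_{\{v_i\}}$ determines the series $P^G_{\{v_i\}}(t_1,\dots,t_r)$. More precisely: $K_0=K_0'\oplus K_0''$ with $K_0''$ an ideal; the projection $\Pi':K_0\to K_0'$ along $K_0''$ is a ring homomorphism; there is a ring isomorphism $\Phi:K_0'\to R_1(G)[[t_1,\dots,t_r]]$ sending each $(G,r)$-set $(X,w,\alpha)$ with trivial action to $\sum_{x\in X}\alpha_x t^{w(x)}$; and, for all $(V,0)$ and $v_1,\dots,v_r$ as above, whenever $P^G_{\{v_i\}}$ exists (i.e. $T$ is integrable), the earlier series exists, is unique, and $$P^G_{\{v_i\}}(t_1,\dots,t_r)=\Phi\bigl(\Pi'(P^G_{\{v_i\}})\bigr).$$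 -/

import Mathlib

open scoped LinearAlgebra.Projectivization Topology

universe u

noncomputable section

namespace EquivPoincare

/-! ### The Grothendieck ring of a commutative semiring -/

/-- The Grothendieck ring of a commutative semiring `S`: the Grothendieck group of `(S, +)`, with
the multiplication induced by that of `S`. -/
def GrothendieckRing (S : Type u) [CommSemiring S] : Type u :=
  Algebra.GrothendieckAddGroup S

namespace GrothendieckRing

variable {S : Type u} [CommSemiring S]

instance : AddCommGroup (GrothendieckRing S) :=
  inferInstanceAs (AddCommGroup (Algebra.GrothendieckAddGroup S))

/-- The class in the Grothendieck ring of an element of `S`. -/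
def of : S →+ GrothendieckRing S := Algebra.GrothendieckAddGroup.of

/-- Additive maps to an abelian group extend to the Grothendieck group. -/
def lift {A : Type*} [AddCommGroup A] (f : S →+ A) : GrothendieckRing S →+ A :=
  Algebra.GrothendieckAddGroup.lift f

theorem lift_of {A : Type*} [AddCommGroup A] (f : S →+ A) (a : S) : lift f (of a) = f a :=
  DFunLike.congr_fun (Algebra.GrothendieckAddGroup.lift.symm_apply_apply f) a

theorem exists_eq (x : GrothendieckRing S) : ∃ a b : S, x = of a - of b := by
  obtain ⟨⟨a, s⟩, h⟩ := (AddLocalization.addMonoidOf (⊤ : AddSubmonoid S)).surj x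
  exact ⟨a, s, eq_sub_of_add_eq h⟩

/-- The biadditive extension of the multiplication of `S`. -/
def mulHom : GrothendieckRing S →+ GrothendieckRing S →+ GrothendieckRing S :=
  lift
    { toFun := fun a => lift (of.comp (AddMonoidHom.mulLeft a))
      map_zero' := by
        ext x
        obtain ⟨b, c, rfl⟩ := exists_eq x
        simp [lift_of]
      map_add' := fun a a' => by
        ext x
        obtain ⟨b, c, rfl⟩ := exists_eq x
        simp [lift_of, add_mul]
        abel }

instance : Mul (GrothendieckRing S) := ⟨fun x y => mulHom x y⟩

instance : One (GrothendieckRing S) := ⟨of 1⟩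

theorem mul_def (x y : GrothendieckRing S) : x * y = mulHom x y := rfl

theorem one_def : (1 : GrothendieckRing S) = of 1 := rfl

theorem of_mul_of (a b : S) : of a * of b = of (a * b) := by
  simp [mul_def, mulHom, lift_of]

private theorem add_mul' (x y z : GrothendieckRing S) : (x + y) * z = x * z + y * z := by
  simp [mul_def]

private theorem mul_add' (x y z : GrothendieckRing S) : x * (y + z) = x * y + x * z := by
  simp [mul_def]

private theorem sub_mul' (x y z : GrothendieckRing S) : (x - y) * z = x * z - y * z := by
  simp [mul_def]

private theorem mul_sub' (x y z : GrothendieckRing S) : x * (y - z) = x * y - x * z := by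
  simp [mul_def]

instance : CommRing (GrothendieckRing S) :=
  { (inferInstance : AddCommGroup (GrothendieckRing S)) with
    mul := (· * ·)
    one := 1
    left_distrib := mul_add'
    right_distrib := add_mul'
    zero_mul := fun x => by simp [mul_def]
    mul_zero := fun x => by simp [mul_def]
    mul_assoc := fun x y z => by
      obtain ⟨a, b, rfl⟩ := exists_eq x
      obtain ⟨c, d, rfl⟩ := exists_eq y
      obtain ⟨e, f, rfl⟩ := exists_eq z
      simp only [sub_mul', mul_sub', of_mul_of, mul_assoc]
    one_mul := fun x => by
      obtain ⟨a, b, rfl⟩ := exists_eq x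
      rw [one_def]
      simp only [mul_sub', of_mul_of, one_mul]
    mul_one := fun x => by
      obtain ⟨a, b, rfl⟩ := exists_eq x
      rw [one_def]
      simp only [sub_mul', of_mul_of, mul_one]
    mul_comm := fun x y => by
      obtain ⟨a, b, rfl⟩ := exists_eq x
      obtain ⟨c, d, rfl⟩ := exists_eq y
      simp only [sub_mul', mul_sub', of_mul_of, mul_comm c, mul_comm d]
      abel }

end GrothendieckRing

/-! ### Locally finite `(G, r)`-sets and their Grothendieck ring -/

/-- A (locally finite) `(G, r)`-set. One-dimensional representations of a group are identified with
its homomorphisms to `ℂˣ`. The cardinality condition makes every such set countable, so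
carriers in `Type` are no restriction. -/
structure GRSet (G : Type u) [Group G] (r : ℕ) where
  carrier : Type
  [action : MulAction G carrier]
  w : carrier → Fin r → ℕ
  α : ∀ x : carrier, MulAction.stabilizer G x →* ℂˣ
  α_conj : ∀ (a : G) (x : carrier) (g : G) (hg : g ∈ MulAction.stabilizer G x)
    (hg' : a * g * a⁻¹ ∈ MulAction.stabilizer G (a • x)), α (a • x) ⟨a * g * a⁻¹, hg'⟩ = α x ⟨g, hg⟩
  locallyFinite : ∀ W : Fin r → ℕ, {x : carrier | w x ≤ W}.Finite

attribute [instance] GRSet.action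

namespace GRSet

variable {G : Type u} [Group G] {r : ℕ}

/-- Two `(G, r)`-sets are isomorphic if there is a `G`-equivariant bijection between them that
respects `w` and `α`. -/
def Isom (A B : GRSet G r) : Prop :=
  ∃ e : A.carrier ≃ B.carrier, (∀ (g : G) x, e (g • x) = g • e x) ∧ (∀ x, B.w (e x) = A.w x) ∧
    ∀ x (g : G) (h : g ∈ MulAction.stabilizer G x) (h' : g ∈ MulAction.stabilizer G (e x)),
      B.α (e x) ⟨g, h'⟩ = A.α x ⟨g, h⟩

theorem Isom.refl (A : GRSet G r) : Isom A A :=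
  ⟨Equiv.refl _, fun _ _ => rfl, fun _ => rfl, fun _ _ _ _ => rfl⟩

theorem Isom.symm {A B : GRSet G r} : Isom A B → Isom B A := by
  rintro ⟨e, h1, h2, h3⟩
  have h1' : ∀ (g : G) x, e.symm (g • x) = g • e.symm x := fun g x => by
    rw [Equiv.symm_apply_eq, h1, Equiv.apply_symm_apply]
  refine ⟨e.symm, h1', fun x => by rw [← h2, Equiv.apply_symm_apply], fun x g h h' => ?_⟩
  obtain ⟨y, rfl⟩ := e.surjective x
  have key : ∀ (z : A.carrier) (hz : z = y) (hz' : g ∈ MulAction.stabilizer G z),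
      A.α z ⟨g, hz'⟩ = B.α (e y) ⟨g, h⟩ := by
    rintro z rfl hz'
    exact (h3 _ _ _ _).symm
  exact key _ (e.symm_apply_apply y) h'

theorem Isom.trans {A B C : GRSet G r} : Isom A B → Isom B C → Isom A C := by
  rintro ⟨e, h1, h2, h3⟩ ⟨f, k1, k2, k3⟩
  refine ⟨e.trans f, fun g x => by simp [h1, k1], fun x => by simp [h2, k2], fun x g h h' => ?_⟩
  have hb : g ∈ MulAction.stabilizer G (e x) := by
    rw [MulAction.mem_stabilizer_iff] at h ⊢
    rw [← h1, h]
  exact (k3 (e x) g hb h').trans (h3 x g h hb)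

instance setoid (G : Type u) [Group G] (r : ℕ) : Setoid (GRSet G r) :=
  ⟨Isom, Isom.refl, Isom.symm, Isom.trans⟩

/-- The empty `(G, r)`-set. -/
def empty (G : Type u) [Group G] (r : ℕ) : GRSet G r where
  carrier := Empty
  action := { smul := fun _ x => x, one_smul := fun _ => rfl, mul_smul := fun _ _ _ => rfl }
  w := fun _ => 0
  α := fun _ => 1
  α_conj := fun _ _ _ _ _ => rfl
  locallyFinite := fun _ => Set.toFinite _

/-- The one-point `(G, r)`-set with `w = 0` and the trivial representation. -/
def unit (G : Type u) [Group G] (r : ℕ) : GRSet G r where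
  carrier := Unit
  action := { smul := fun _ x => x, one_smul := fun _ => rfl, mul_smul := fun _ _ _ => rfl }
  w := fun _ => 0
  α := fun _ => 1
  α_conj := fun _ _ _ _ _ => rfl
  locallyFinite := fun _ => Set.toFinite _

theorem mem_stab_inl {X Y : Type} [MulAction G X] [MulAction G Y] {x : X} {g : G}
    (h : g ∈ MulAction.stabilizer G (Sum.inl x : X ⊕ Y)) : g ∈ MulAction.stabilizer G x :=
  Sum.inl_injective h

theorem mem_stab_inr {X Y : Type} [MulAction G X] [MulAction G Y] {y : Y} {g : G}
    (h : g ∈ MulAction.stabilizer G (Sum.inr y : X ⊕ Y)) : g ∈ MulAction.stabilizer G y :=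
  Sum.inr_injective h

theorem mem_stab_fst {X Y : Type} [MulAction G X] [MulAction G Y] {p : X × Y} {g : G}
    (h : g ∈ MulAction.stabilizer G p) : g ∈ MulAction.stabilizer G p.1 :=
  congrArg Prod.fst h

theorem mem_stab_snd {X Y : Type} [MulAction G X] [MulAction G Y] {p : X × Y} {g : G}
    (h : g ∈ MulAction.stabilizer G p) : g ∈ MulAction.stabilizer G p.2 :=
  congrArg Prod.snd h

/-- The disjoint union. -/
def sum (A B : GRSet G r) : GRSet G r where
  carrier := A.carrier ⊕ B.carrier
  w := Sum.elim A.w B.w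
  α := fun x => match x with
    | Sum.inl x => (A.α x).comp (Subgroup.inclusion fun _ h => mem_stab_inl h)
    | Sum.inr y => (B.α y).comp (Subgroup.inclusion fun _ h => mem_stab_inr h)
  α_conj := by
    rintro a (x | y) g hg hg'
    · exact A.α_conj a x g (mem_stab_inl hg) (mem_stab_inl hg')
    · exact B.α_conj a y g (mem_stab_inr hg) (mem_stab_inr hg')
  locallyFinite := fun W => by
    refine (((A.locallyFinite W).image Sum.inl).union
      ((B.locallyFinite W).image Sum.inr)).subset ?_
    rintro (x | y) h
    · exact Or.inl ⟨x, h, rfl⟩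
    · exact Or.inr ⟨y, h, rfl⟩

/-- The Cartesian product: the function `w` is added, the representations are multiplied. -/
def prod (A B : GRSet G r) : GRSet G r where
  carrier := A.carrier × B.carrier
  w := fun p => A.w p.1 + B.w p.2
  α := fun p => (A.α p.1).comp (Subgroup.inclusion fun _ h => mem_stab_fst h) *
    (B.α p.2).comp (Subgroup.inclusion fun _ h => mem_stab_snd h)
  α_conj := by
    rintro a ⟨x, y⟩ g hg hg'
    exact congrArg₂ (· * ·) (A.α_conj a x g (mem_stab_fst hg) (mem_stab_fst hg'))
      (B.α_conj a y g (mem_stab_snd hg) (mem_stab_snd hg'))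
  locallyFinite := fun W => by
    refine ((A.locallyFinite W).prod (B.locallyFinite W)).subset ?_
    rintro ⟨x, y⟩ h
    have h' : A.w x + B.w y ≤ W := h
    exact ⟨fun i => (Nat.le_add_right _ _).trans (h' i), fun i => (Nat.le_add_left _ _).trans (h' i)⟩

theorem sum_congr {A A' B B' : GRSet G r} : Isom A A' → Isom B B' → Isom (sum A B) (sum A' B') := by
  rintro ⟨e, h1, h2, h3⟩ ⟨f, k1, k2, k3⟩
  refine ⟨Equiv.sumCongr e f, ?_, ?_, ?_⟩
  · rintro g (x | y)
    · exact congrArg Sum.inl (h1 g x)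
    · exact congrArg Sum.inr (k1 g y)
  · rintro (x | y)
    · exact h2 x
    · exact k2 y
  · rintro (x | y) g h h'
    · exact h3 x g (mem_stab_inl h) (mem_stab_inl h')
    · exact k3 y g (mem_stab_inr h) (mem_stab_inr h')

theorem prod_congr {A A' B B' : GRSet G r} :
    Isom A A' → Isom B B' → Isom (prod A B) (prod A' B') := by
  rintro ⟨e, h1, h2, h3⟩ ⟨f, k1, k2, k3⟩
  refine ⟨Equiv.prodCongr e f, ?_, ?_, ?_⟩
  · rintro g ⟨x, y⟩
    exact Prod.ext (h1 g x) (k1 g y)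
  · rintro ⟨x, y⟩
    exact congrArg₂ (· + ·) (h2 x) (k2 y)
  · rintro ⟨x, y⟩ g h h'
    exact congrArg₂ (· * ·) (h3 x g (mem_stab_fst h) (mem_stab_fst h'))
      (k3 y g (mem_stab_snd h) (mem_stab_snd h'))

end GRSet

/-- Isomorphism classes of (locally finite) `(G, r)`-sets. -/
def GRClass (G : Type u) [Group G] (r : ℕ) : Type (max 1 u) := Quotient (GRSet.setoid G r)

namespace GRClass

variable {G : Type u} [Group G] {r : ℕ}

instance : Add (GRClass G r) := ⟨Quotient.map₂ GRSet.sum fun _ _ h _ _ k => GRSet.sum_congr h k⟩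

instance : Mul (GRClass G r) := ⟨Quotient.map₂ GRSet.prod fun _ _ h _ _ k => GRSet.prod_congr h k⟩

instance : Zero (GRClass G r) := ⟨Quotient.mk _ (GRSet.empty G r)⟩

instance : One (GRClass G r) := ⟨Quotient.mk _ (GRSet.unit G r)⟩

private theorem add_comm' (a b : GRClass G r) : a + b = b + a := by
  induction a using Quotient.inductionOn with | _ A
  induction b using Quotient.inductionOn with | _ B
  refine Quotient.sound ⟨Equiv.sumComm _ _, ?_, ?_, ?_⟩
  · rintro g (x | y) <;> rfl
  · rintro (x | y) <;> rfl
  · rintro (x | y) g h h' <;> rfl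

private theorem zero_add' (a : GRClass G r) : 0 + a = a := by
  induction a using Quotient.inductionOn with | _ A
  refine Quotient.sound ⟨Equiv.emptySum Empty _, ?_, ?_, ?_⟩
  · rintro g (x | y)
    · exact x.elim
    · rfl
  · rintro (x | y)
    · exact x.elim
    · rfl
  · rintro (x | y) g h h'
    · exact x.elim
    · rfl

private theorem mul_comm' (a b : GRClass G r) : a * b = b * a := by
  induction a using Quotient.inductionOn with | _ A
  induction b using Quotient.inductionOn with | _ B
  refine Quotient.sound ⟨Equiv.prodComm _ _, ?_, ?_, ?_⟩
  · rintro g ⟨x, y⟩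
    rfl
  · rintro ⟨x, y⟩
    exact add_comm _ _
  · rintro ⟨x, y⟩ g h h'
    exact mul_comm _ _

private theorem one_mul' (a : GRClass G r) : 1 * a = a := by
  induction a using Quotient.inductionOn with | _ A
  refine Quotient.sound ⟨Equiv.punitProd _, ?_, ?_, ?_⟩
  · rintro g ⟨x, y⟩
    rfl
  · rintro ⟨x, y⟩
    exact (zero_add _).symm
  · rintro ⟨x, y⟩ g h h'
    exact (one_mul _).symm

private theorem zero_mul' (a : GRClass G r) : 0 * a = 0 := by
  induction a using Quotient.inductionOn with | _ A
  refine Quotient.sound ⟨⟨fun x => x.1, fun x => x.elim, fun x => x.1.elim, fun x => x.elim⟩,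
    ?_, ?_, ?_⟩
  · rintro g ⟨x, y⟩
    exact x.elim
  · rintro ⟨x, y⟩
    exact x.elim
  · rintro ⟨x, y⟩
    exact x.elim

private theorem left_distrib' (a b c : GRClass G r) : a * (b + c) = a * b + a * c := by
  induction a using Quotient.inductionOn with | _ A
  induction b using Quotient.inductionOn with | _ B
  induction c using Quotient.inductionOn with | _ C
  refine Quotient.sound ⟨Equiv.prodSumDistrib _ _ _, ?_, ?_, ?_⟩
  · rintro g ⟨x, y | z⟩ <;> rfl
  · rintro ⟨x, y | z⟩ <;> rfl
  · rintro ⟨x, y | z⟩ g h h' <;> rfl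

/-- The semiring of `(G, r)`-sets: disjoint union and Cartesian product. -/
instance : CommSemiring (GRClass G r) where
  add := (· + ·)
  zero := 0
  mul := (· * ·)
  one := 1
  nsmul := nsmulRec
  add_comm := add_comm'
  zero_add := zero_add'
  add_zero := fun a => by rw [add_comm', zero_add']
  mul_comm := mul_comm'
  one_mul := one_mul'
  mul_one := fun a => by rw [mul_comm', one_mul']
  zero_mul := zero_mul'
  mul_zero := fun a => by rw [mul_comm', zero_mul']
  left_distrib := left_distrib'
  right_distrib := fun a b c => by
    rw [mul_comm', left_distrib', mul_comm' c a, mul_comm' c b]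
  add_assoc := fun a b c => by
    induction a using Quotient.inductionOn with | _ A
    induction b using Quotient.inductionOn with | _ B
    induction c using Quotient.inductionOn with | _ C
    refine Quotient.sound ⟨Equiv.sumAssoc _ _ _, ?_, ?_, ?_⟩
    · rintro g ((x | y) | z) <;> rfl
    · rintro ((x | y) | z) <;> rfl
    · rintro ((x | y) | z) g h h' <;> rfl
  mul_assoc := fun a b c => by
    induction a using Quotient.inductionOn with | _ A
    induction b using Quotient.inductionOn with | _ B
    induction c using Quotient.inductionOn with | _ C
    refine Quotient.sound ⟨Equiv.prodAssoc _ _ _, ?_, ?_, ?_⟩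
    · rintro g ⟨⟨x, y⟩, z⟩
      rfl
    · rintro ⟨⟨x, y⟩, z⟩
      exact (add_assoc _ _ _).symm
    · rintro ⟨⟨x, y⟩, z⟩ g h h'
      exact (mul_assoc _ _ _).symm

end GRClass

/-- The Grothendieck ring `K₀((G, r)-sets)`. -/
abbrev K₀ (G : Type u) [Group G] (r : ℕ) : Type (max 1 u) := GrothendieckRing (GRClass G r)

/-- The class of a `(G, r)`-set in `K₀((G, r)-sets)`. -/
def GRSet.cls {G : Type u} [Group G] {r : ℕ} (A : GRSet G r) : K₀ G r :=
  GrothendieckRing.of (Quotient.mk (GRSet.setoid G r) A)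

/-- The subgroup of `K₀((G, r)-sets)` generated by the `(G, r)`-sets without points `x` such that
`w x ≤ W`. -/
def K₀.tail (G : Type u) [Group G] (r : ℕ) (W : Fin r → ℕ) : AddSubgroup (K₀ G r) :=
  AddSubgroup.closure {y | ∃ A : GRSet G r, (∀ x, ¬ A.w x ≤ W) ∧ y = A.cls}

/-- The topology on `K₀((G, r)-sets)` in which infinite sums are taken: the cosets of the subgroups
`K₀.tail G r W` are a basis. -/
instance (G : Type u) [Group G] (r : ℕ) : TopologicalSpace (K₀ G r) :=
  TopologicalSpace.generateFrom {U | ∃ (y : K₀ G r) (W : Fin r → ℕ), U = {z | z - y ∈ K₀.tail G r W}}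

/-- `K₀'`: the subring generated by the classes of the `(G, r)`-sets with trivial action. -/
def K₀' (G : Type u) [Group G] (r : ℕ) : Subring (K₀ G r) :=
  Subring.closure {y | ∃ A : GRSet G r, (∀ (g : G) (x : A.carrier), g • x = x) ∧ y = A.cls}

/-- `K₀''`: the (non-unital) subring generated by the classes of the `(G, r)`-sets without
fixed points. -/
def K₀'' (G : Type u) [Group G] (r : ℕ) : NonUnitalSubring (K₀ G r) :=
  NonUnitalSubring.closure
    {y | ∃ A : GRSet G r, (∀ x : A.carrier, ∃ g : G, g • x ≠ x) ∧ y = A.cls}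

theorem GRSet.cls_mem {G : Type u} [Group G] {r : ℕ} (A : GRSet G r)
    (hA : ∀ (g : G) (x : A.carrier), g • x = x) : A.cls ∈ K₀' G r :=
  Subring.subset_closure ⟨A, hA, rfl⟩

/-! ### The ring `R₁(G)[[t₁, …, t_r]]` -/

/-- The subring `R₁(G)` of the representation ring generated by the one-dimensional
representations. Virtual complex representations of the finite group `G` are
identified with their characters. -/
def R₁ (G : Type u) [Group G] : Subring (G → ℂ) :=
  Subring.closure (Set.range fun (α : G →* ℂˣ) (g : G) => (α g : ℂ))

/-- The one-dimensional representation `α` as an element of `R₁(G)`. -/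
def R₁.of {G : Type u} [Group G] (α : G →* ℂˣ) : R₁ G :=
  ⟨fun g => (α g : ℂ), Subring.subset_closure ⟨α, rfl⟩⟩

/-- The ring of power series `R₁(G)[[t₁, …, t_r]]`. -/
def Series (G : Type u) [Group G] (r : ℕ) : Type u := MvPowerSeries (Fin r) (R₁ G)

instance (G : Type u) [Group G] (r : ℕ) : CommRing (Series G r) :=
  inferInstanceAs (CommRing (MvPowerSeries (Fin r) (R₁ G)))

/-- The topology of coefficientwise stabilization, in which infinite sums of series are taken. -/
instance (G : Type u) [Group G] (r : ℕ) : TopologicalSpace (Series G r) :=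
  @MvPowerSeries.WithPiTopology.instTopologicalSpace (Fin r) (R₁ G) ⊥

/-- The coefficient of `t₁^{w₁} ⋯ t_r^{w_r}`. -/
def Series.coeff {G : Type u} [Group G] {r : ℕ} (w : Fin r → ℕ) (s : Series G r) : R₁ G :=
  MvPowerSeries.coeff (Finsupp.equivFunOnFinite.symm w) s

/-- The monomial `α t₁^{w₁} ⋯ t_r^{w_r}`. -/
def Series.monomial {G : Type u} [Group G] {r : ℕ} (w : Fin r → ℕ) (α : R₁ G) : Series G r :=
  MvPowerSeries.monomial (Finsupp.equivFunOnFinite.symm w) α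

/-! ### Germs of analytic varieties with a group action -/

/-- A germ at the origin of a complex analytic variety `V ⊆ ℂⁿ` with an action of `G` by germs of
analytic maps `φ a : (V, 0) → (V, 0)`. -/
structure VarietyGerm (G : Type u) [Group G] where
  n : ℕ
  V : Set (Fin n → ℂ)
  zero_mem : 0 ∈ V
  analytic : ∃ (N : ℕ) (F : Fin N → (Fin n → ℂ) → ℂ), (∀ i, AnalyticAt ℂ (F i) 0) ∧
    ∀ᶠ x in 𝓝 0, x ∈ V ↔ ∀ i, F i x = 0
  φ : G → (Fin n → ℂ) → (Fin n → ℂ)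
  φ_analytic : ∀ a, AnalyticAt ℂ (φ a) 0
  φ_zero : ∀ a, φ a 0 = 0
  φ_mem : ∀ a, ∀ᶠ x in 𝓝[V] 0, φ a x ∈ V
  φ_one : ∀ᶠ x in 𝓝[V] 0, φ 1 x = x
  φ_mul : ∀ a b, ∀ᶠ x in 𝓝[V] 0, φ (a * b) x = φ a (φ b x)

namespace VarietyGerm

variable {G : Type u} [Group G] (X : VarietyGerm G)

/-- The algebra of functions on the ambient space that are analytic at the origin. -/
def ambient : Subalgebra ℂ ((Fin X.n → ℂ) → ℂ) where
  carrier := {F | AnalyticAt ℂ F 0}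
  mul_mem' := fun h k => AnalyticAt.mul h k
  add_mem' := fun h k => AnalyticAt.add h k
  algebraMap_mem' := fun _ => analyticAt_const

/-- The ideal of the functions that vanish on `V` near the origin. -/
def vanishing : Ideal X.ambient where
  carrier := {F | ∀ᶠ x in 𝓝[X.V] 0, F.1 x = 0}
  add_mem' := fun {F H} hF hH => by
    change ∀ᶠ x in 𝓝[X.V] 0, F.1 x + H.1 x = 0
    filter_upwards [hF, hH] with x h k
    rw [h, k, add_zero]
  zero_mem' := by
    change ∀ᶠ x in 𝓝[X.V] 0, (0 : ℂ) = 0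
    simp
  smul_mem' := fun F H hH => by
    change ∀ᶠ x in 𝓝[X.V] 0, F.1 x * H.1 x = 0
    filter_upwards [hH] with x h
    rw [h, mul_zero]

/-- The ring `𝒪_{V,0}` of germs of (analytic) functions on `(V, 0)`. -/
def O : Type := X.ambient ⧸ X.vanishing

instance : CommRing X.O := inferInstanceAs (CommRing (X.ambient ⧸ X.vanishing))

instance : Algebra ℂ X.O := inferInstanceAs (Algebra ℂ (X.ambient ⧸ X.vanishing))

/-- The germ on `(V, 0)` of a function that is analytic at the origin of the ambient space. -/
def germ : X.ambient →ₐ[ℂ] X.O := Ideal.Quotient.mkₐ ℂ X.vanishing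

theorem germ_surjective : Function.Surjective X.germ := Ideal.Quotient.mk_surjective

theorem germ_eq_iff (F H : X.ambient) :
    X.germ F = X.germ H ↔ ∀ᶠ x in 𝓝[X.V] 0, F.1 x = H.1 x := by
  refine (Ideal.Quotient.eq (I := X.vanishing)).trans ?_
  change (∀ᶠ x in 𝓝[X.V] 0, F.1 x - H.1 x = 0) ↔ _
  simp only [sub_eq_zero]

theorem φ_tendsto (a : G) : Filter.Tendsto (X.φ a) (𝓝[X.V] 0) (𝓝[X.V] 0) := by
  refine tendsto_nhdsWithin_iff.2 ⟨?_, X.φ_mem a⟩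
  have h := (X.φ_analytic a).continuousAt.tendsto
  rw [X.φ_zero a] at h
  exact h.mono_left nhdsWithin_le_nhds

/-- The composition `F ↦ F ∘ φ (a⁻¹)`. -/
def pull (a : G) : X.ambient →ₐ[ℂ] X.ambient where
  toFun := fun F => ⟨F.1 ∘ X.φ a⁻¹, by
    have h : AnalyticAt ℂ F.1 (X.φ a⁻¹ 0) := by
      rw [X.φ_zero]
      exact F.2
    exact h.comp (X.φ_analytic a⁻¹)⟩
  map_one' := rfl
  map_mul' := fun _ _ => rfl
  map_zero' := rfl
  map_add' := fun _ _ => rfl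
  commutes' := fun _ => rfl

/-- The map `f ↦ a^* f` on germs of functions, `a^* f (x) = f (a⁻¹ x)`. -/
def act (a : G) : X.O →ₐ[ℂ] X.O :=
  Ideal.Quotient.liftₐ X.vanishing (X.germ.comp (X.pull a)) fun F hF => by
    have h : X.germ (X.pull a F) = X.germ 0 := (X.germ_eq_iff _ _).2 ((X.φ_tendsto a⁻¹).eventually hF)
    simpa using h

theorem act_germ (a : G) (F : X.ambient) : X.act a (X.germ F) = X.germ (X.pull a F) := rfl

/-- The action of `G` on `𝒪_{V,0}`: `(a • f) (x) = f (a⁻¹ x)`. -/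
instance : MulSemiringAction G X.O where
  smul := fun a f => X.act a f
  one_smul := fun f => by
    obtain ⟨F, rfl⟩ := X.germ_surjective f
    refine (X.germ_eq_iff _ _).2 ?_
    filter_upwards [X.φ_one] with x hx
    change F.1 (X.φ 1⁻¹ x) = F.1 x
    rw [inv_one, hx]
  mul_smul := fun a b f => by
    obtain ⟨F, rfl⟩ := X.germ_surjective f
    refine (X.germ_eq_iff _ _).2 ?_
    filter_upwards [X.φ_mul b⁻¹ a⁻¹] with x hx
    change F.1 (X.φ (a * b)⁻¹ x) = F.1 (X.φ b⁻¹ (X.φ a⁻¹ x))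
    rw [mul_inv_rev, hx]
  smul_zero := fun a => map_zero (X.act a)
  smul_add := fun a => map_add (X.act a)
  smul_one := fun a => map_one (X.act a)
  smul_mul := fun a => map_mul (X.act a)

theorem smul_def (a : G) (f : X.O) : a • f = X.act a f := rfl

instance : SMulCommClass G ℂ X.O := ⟨fun a c f => map_smul (X.act a) c f⟩

/-- The value of a germ at the origin. -/
def eval : X.O →ₐ[ℂ] ℂ :=
  Ideal.Quotient.liftₐ X.vanishing
    ((Pi.evalAlgHom ℂ (fun _ : Fin X.n → ℂ => ℂ) 0).comp X.ambient.val)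
    fun F hF => by
      have h : ∀ᶠ x in 𝓝[X.V] 0, F.1 x = 0 := hF
      exact h.self_of_nhdsWithin X.zero_mem

theorem eval_smul (a : G) (f : X.O) : X.eval (a • f) = X.eval f := by
  obtain ⟨F, rfl⟩ := X.germ_surjective f
  change F.1 (X.φ a⁻¹ 0) = F.1 0
  rw [X.φ_zero]

/-- The maximal ideal of `𝒪_{V,0}`: the germs that vanish at the origin. -/
def m : Ideal X.O := RingHom.ker X.eval

theorem act_mem_pow (a : G) (k : ℕ) {f : X.O} (hf : f ∈ X.m ^ k) : X.act a f ∈ X.m ^ k := by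
  have h : X.m.map (X.act a) ≤ X.m := Ideal.map_le_iff_le_comap.2 fun g hg => by
    change X.eval (a • g) = 0
    rw [eval_smul]
    exact hg
  have h2 := Ideal.mem_map_of_mem (X.act a) hf
  rw [Ideal.map_pow] at h2
  exact Ideal.pow_right_mono h k h2

/-- The space `J^k_{V,0} = 𝒪_{V,0} / 𝔪^{k+1}` of `k`-jets. -/
def J (k : ℕ) : Type := X.O ⧸ X.m ^ (k + 1)

instance (k : ℕ) : CommRing (X.J k) := inferInstanceAs (CommRing (X.O ⧸ X.m ^ (k + 1)))

instance (k : ℕ) : Algebra ℂ (X.J k) := inferInstanceAs (Algebra ℂ (X.O ⧸ X.m ^ (k + 1)))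

/-- The `k`-jet of a germ. -/
def jet (k : ℕ) : X.O →ₐ[ℂ] X.J k := Ideal.Quotient.mkₐ ℂ (X.m ^ (k + 1))

theorem jet_surjective (k : ℕ) : Function.Surjective (X.jet k) := Ideal.Quotient.mk_surjective

/-- The action of an element of `G` on jets. -/
def jetAct (k : ℕ) (a : G) : X.J k →ₐ[ℂ] X.J k :=
  Ideal.Quotient.liftₐ (X.m ^ (k + 1)) ((X.jet k).comp (X.act a)) fun _ hf =>
    Ideal.Quotient.eq_zero_iff_mem.2 (X.act_mem_pow a (k + 1) hf)

theorem jetAct_jet (k : ℕ) (a : G) (f : X.O) : X.jetAct k a (X.jet k f) = X.jet k (a • f) := rfl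

instance (k : ℕ) : MulSemiringAction G (X.J k) where
  smul := fun a j => X.jetAct k a j
  one_smul := fun j => by
    obtain ⟨f, rfl⟩ := X.jet_surjective k j
    exact congrArg (X.jet k) (one_smul G f)
  mul_smul := fun a b j => by
    obtain ⟨f, rfl⟩ := X.jet_surjective k j
    exact congrArg (X.jet k) (mul_smul a b f)
  smul_zero := fun a => map_zero (X.jetAct k a)
  smul_add := fun a => map_add (X.jetAct k a)
  smul_one := fun a => map_one (X.jetAct k a)
  smul_mul := fun a => map_mul (X.jetAct k a)

instance (k : ℕ) : SMulCommClass G ℂ (X.J k) := ⟨fun a c j => map_smul (X.jetAct k a) c j⟩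

open Classical in
/-- The map `π_k : ℙ𝒪_{V,0} → ℙ^* J^k_{V,0} = ℙ J^k_{V,0} ∪ {*}`; the added point `*` is `none`. -/
def projJet (k : ℕ) (p : ℙ ℂ X.O) : Option (ℙ ℂ (X.J k)) :=
  if h : X.jet k p.rep ≠ 0 then some (Projectivization.mk ℂ (X.jet k p.rep) h) else none

end VarietyGerm

/-! ### Constructible sets and the Euler characteristic -/

/-- Algebraic subsets of `ℙ M`: common zeros of finitely many homogeneous polynomials in
linear functions on `M`. -/
def IsAlgebraicSubset {M : Type} [AddCommGroup M] [Module ℂ M] (Z : Set (ℙ ℂ M)) : Prop :=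
  ∃ S : Finset (MvPolynomial (Module.Dual ℂ M) ℂ), (∀ F ∈ S, ∃ d, F.IsHomogeneous d) ∧
    Z = {p | ∀ F ∈ S, MvPolynomial.eval (fun l : Module.Dual ℂ M => l p.rep) F = 0}

/-- Constructible subsets of `ℙ M`: the Boolean algebra generated by the algebraic subsets. -/
def IsConstructibleSubset {M : Type} [AddCommGroup M] [Module ℂ M] (Z : Set (ℙ ℂ M)) : Prop :=
  Z ∈ BooleanSubalgebra.closure {Y : Set (ℙ ℂ M) | IsAlgebraicSubset Y}

/-- The usual (complex) topology on the projectivization of a finite-dimensional space: the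
quotient topology from `M ∖ {0}`. -/
instance projTopology (M : Type) [AddCommGroup M] [Module ℂ M] : TopologicalSpace (ℙ ℂ M) :=
  TopologicalSpace.coinduced (fun v : {v : M // v ≠ 0} => Projectivization.mk ℂ v.1 v.2)
    (TopologicalSpace.induced Subtype.val (moduleTopology ℂ M))

/-- The Euler characteristic of a topological space: the alternating sum of the dimensions of the
rational singular homology groups. (For constructible sets it is equal to the one
defined by cohomology with compact support.) -/
def eulerChar (Y : Type) [TopologicalSpace Y] : ℤ :=
  ∑ᶠ n : ℕ, (-1 : ℤ) ^ n *
    (Module.finrank ℚ (((AlgebraicTopology.singularHomologyFunctor (ModuleCat.{0} ℚ) n).obj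
      (ModuleCat.of ℚ ℚ)).obj (TopCat.of Y)) : ℤ)

/-- The integral with respect to the Euler characteristic: `χ B c` says that `B ⊆ Y` is
cylindric with Euler characteristic `c`. A function `ψ` has integral `I` if `ψ⁻¹(a)` is cylindric
for all `a ≠ 0` and `∑_{a ≠ 0} χ(ψ⁻¹(a)) a` converges to `I`. -/
def HasIntegral {Y A : Type*} [AddCommGroup A] [TopologicalSpace A] (χ : Set Y → ℤ → Prop)
    (ψ : Y → A) (I : A) : Prop :=
  ∃ c : A → ℤ, (∀ a, a ≠ 0 → χ (ψ ⁻¹' {a}) (c a)) ∧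
    HasSum (fun a : {a : A // a ≠ 0} => c a.1 • a.1) I

/-! ### Isotropy representations of points of a projective space -/

section Isotropy

variable {G : Type u} [Group G] {E : Type} [AddCommGroup E] [Module ℂ E]
  [DistribMulAction G E] [SMulCommClass G ℂ E]

theorem exists_isotropy (p : ℙ ℂ E) (a : MulAction.stabilizer G p) :
    ∃ c : ℂˣ, (a : G) • p.rep = c • p.rep := by
  have h : (a : G) • p = p := a.2
  have h2 : Projectivization.mk ℂ ((a : G) • p.rep) ((smul_ne_zero_iff_ne _).mpr p.rep_nonzero) =
      Projectivization.mk ℂ p.rep p.rep_nonzero := by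
    rw [← Projectivization.smul_mk _ p.rep_nonzero, p.mk_rep, h]
  obtain ⟨c, hc⟩ := (Projectivization.mk_eq_mk_iff _ _ _ _ _).1 h2
  exact ⟨c, hc.symm⟩

theorem unit_smul_injective {v : E} (hv : v ≠ 0) {c d : ℂˣ} (h : c • v = d • v) : c = d :=
  Units.ext (smul_left_injective ℂ hv h)

/-- The representation `λ_f` of the isotropy group `G_f` of a point `f` of the projectivization:
`a • f = λ_f(a) f`. -/
def isotropyRep (p : ℙ ℂ E) : MulAction.stabilizer G p →* ℂˣ :=
  MonoidHom.mk' (fun a => (exists_isotropy p a).choose) fun a b => by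
    have ha := (exists_isotropy p a).choose_spec
    have hb := (exists_isotropy p b).choose_spec
    have hab := (exists_isotropy p (a * b)).choose_spec
    apply unit_smul_injective p.rep_nonzero
    refine hab.symm.trans ?_
    generalize (exists_isotropy p a).choose = c at *
    generalize (exists_isotropy p b).choose = d at *
    rw [Subgroup.coe_mul, mul_smul, hb, mul_comm c d, mul_smul, Units.smul_def d, smul_comm, ha,
      ← Units.smul_def d]

theorem isotropyRep_spec (p : ℙ ℂ E) (a : MulAction.stabilizer G p) {v : E} (hv : v ≠ 0)
    (hp : Projectivization.mk ℂ v hv = p) : (a : G) • v = isotropyRep p a • v := by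
  have h : (a : G) • p.rep = isotropyRep p a • p.rep := (exists_isotropy p a).choose_spec
  obtain ⟨c, hc⟩ := (Projectivization.mk_eq_mk_iff _ _ _ _ p.rep_nonzero).1 (hp.trans p.mk_rep.symm)
  rw [← hc, Units.smul_def c, smul_comm, h, smul_comm]

theorem isotropyRep_conj (p : ℙ ℂ E) (a g : G) (hg : g ∈ MulAction.stabilizer G p)
    (hg' : a * g * a⁻¹ ∈ MulAction.stabilizer G (a • p)) :
    isotropyRep (a • p) ⟨a * g * a⁻¹, hg'⟩ = isotropyRep p ⟨g, hg⟩ := by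
  have hv : a • p.rep ≠ 0 := (smul_ne_zero_iff_ne a).mpr p.rep_nonzero
  have hp : Projectivization.mk ℂ (a • p.rep) hv = a • p := by
    conv_rhs => rw [← p.mk_rep]
    rfl
  apply unit_smul_injective hv
  rw [← isotropyRep_spec (a • p) ⟨_, hg'⟩ hv hp]
  simp only [mul_smul, inv_smul_smul]
  have h2 : g • p.rep = isotropyRep p ⟨g, hg⟩ • p.rep :=
    isotropyRep_spec p ⟨g, hg⟩ p.rep_nonzero p.mk_rep
  rw [h2, Units.smul_def, smul_comm, ← Units.smul_def]

end Isotropy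

/-! ### Order functions and the two Poincaré series -/

/-- Order functions. -/
structure IsOrderFunction {E : Type} [AddCommGroup E] [Module ℂ E] (v : E → ℕ∞) : Prop where
  smul : ∀ (c : ℂ) (f : E), c ≠ 0 → v (c • f) = v f
  add : ∀ f g : E, min (v f) (v g) ≤ v (f + g)

namespace VarietyGerm

variable {G : Type u} [Group G] (X : VarietyGerm G) {r : ℕ} (v : Fin r → X.O → ℕ∞)

/-- The filtration `J(w) = {f : v(f) ≥ w}` is finitely determined: each of its members contains a
power of the maximal ideal. -/
def FinitelyDetermined : Prop :=
  ∀ w : Fin r → ℕ, ∃ k : ℕ, ∀ f ∈ X.m ^ k, ∀ i, (w i : ℕ∞) ≤ v i f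

/-- The factor space `ℙ𝒪_{V,0} / G`. -/
abbrev ProjO : Type := MulAction.orbitRel.Quotient G (ℙ ℂ X.O)

/-- The factor space `ℙ J^k_{V,0} / G`. -/
abbrev ProjJ (k : ℕ) : Type := MulAction.orbitRel.Quotient G (ℙ ℂ (X.J k))

/-- `X.OrbitEuler B c`: the set `B ⊆ ℙ𝒪_{V,0}/G` is cylindric with Euler characteristic `c`.

For all large `k`, the set `B` does not meet `π_k⁻¹(*)`, and among the points `f` whose
isotropy group `G_f` is already the isotropy group of the `k`-jet of `f`, the set `B` is the
preimage of a constructible subset `Z` of `ℙ J^k_{V,0}/G` with `χ(Z) = c`.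

The points `f` with that property exhaust `ℙ𝒪_{V,0}` as `k` grows; they map onto `ℙ J^k_{V,0}` with
affine spaces as fibres (the lifts of a jet `j` that are equivariant for its isotropy
group, with the same character). For trivial `G` the condition on isotropy groups is void and
`B = π_k⁻¹(Z)`. The condition cannot be dropped: no jet of a `G`-equivariant function
determines that the function is equivariant. -/
def OrbitEuler (B : Set X.ProjO) (c : ℤ) : Prop :=
  ∃ k₀ : ℕ, ∀ k ≥ k₀, ∃ Z : Set (X.ProjJ k),
    IsConstructibleSubset {q : ℙ ℂ (X.J k) | (Quotient.mk'' q : X.ProjJ k) ∈ Z} ∧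
    eulerChar Z = c ∧
    (∀ p : ℙ ℂ X.O, (Quotient.mk'' p : X.ProjO) ∈ B → X.projJet k p ≠ none) ∧
    ∀ (p : ℙ ℂ X.O) (q : ℙ ℂ (X.J k)), X.projJet k p = some q →
      MulAction.stabilizer G p = MulAction.stabilizer G q →
        ((Quotient.mk'' p : X.ProjO) ∈ B ↔ (Quotient.mk'' q : X.ProjJ k) ∈ Z)

/-- The orbit of a point of `ℙ𝒪_{V,0}` as a `(G, r)`-set: `w(f) = v(f)`, `α_f = λ_f`
(meaningful if no `v_i` is infinite on the orbit). -/
def orbitSet [Finite G] (ω : X.ProjO) : GRSet G r where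
  carrier := ω.orbit
  w := fun x i => (v i x.1.rep).toNat
  α := fun x => (isotropyRep x.1).comp
    (Subgroup.inclusion fun _ h => congrArg Subtype.val (h : _ • x = x))
  α_conj := fun a x g hg hg' => isotropyRep_conj x.1 a g (congrArg Subtype.val hg)
    (congrArg Subtype.val hg')
  locallyFinite := fun _ => by
    have : Finite ω.orbit := by
      induction ω using Quotient.inductionOn' with | _ p
      exact Set.finite_range fun g : G => g • p
    exact Set.toFinite _

open Classical in
/-- The function `T : ℙ𝒪_{V,0}/G → K₀((G, r)-sets)`. -/
def T [Finite G] (ω : X.ProjO) : K₀ G r :=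
  if ∀ x ∈ ω.orbit, ∀ i, v i x.rep ≠ ⊤ then (X.orbitSet v ω).cls else 0

/-- `P` is the equivariant Poincaré series `∫ T_f dχ` over `ℙ𝒪_{V,0}/G`, as an element of
`K₀((G, r)-sets)`. -/
def IsEquivariantPoincareSeries [Finite G] (P : K₀ G r) : Prop :=
  HasIntegral X.OrbitEuler (X.T v) P

/-- The subspace of the functions equivariant with respect to the one-dimensional
representation `α`: `a^* f = α(a) f`. -/
def equivariantFunctions (α : G →* ℂˣ) : Submodule ℂ X.O where
  carrier := {f | ∀ a : G, a • f = (α a : ℂ) • f}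
  add_mem' := fun {f g} hf hg a => by
    rw [smul_add, smul_add, hf a, hg a]
  zero_mem' := fun a => by rw [smul_zero, smul_zero]
  smul_mem' := fun c f hf a => by rw [smul_comm, hf a, smul_comm]

/-- The projectivization of the union of the subspaces of equivariant functions. -/
def ProjEquiv : Type := {p : ℙ ℂ X.O // ∃ α : G →* ℂˣ, p.rep ∈ X.equivariantFunctions α}

/-- `X.EquivEuler B c`: the subset `B` of the projectivization of the union of the spaces of
equivariant functions is cylindric with Euler characteristic `c`: for all large `k` it is the
preimage of a constructible set `Z` of (projectivized) `k`-jets of equivariant functions,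
and `χ(Z) = c`. -/
def EquivEuler (B : Set X.ProjEquiv) (c : ℤ) : Prop :=
  ∃ k₀ : ℕ, ∀ k ≥ k₀, ∃ Z : Set (ℙ ℂ (X.J k)),
    IsConstructibleSubset Z ∧ eulerChar Z = c ∧
    (∀ q ∈ Z, ∃ p : X.ProjEquiv, X.projJet k p.1 = some q) ∧
    B = {p | ∃ q ∈ Z, X.projJet k p.1 = some q}

open Classical in
/-- The function `α t^{v(f)}` of a function `f` that is equivariant with respect to `α`, where
`t^{+∞} = 0`. -/
def equivMonomial (p : X.ProjEquiv) : Series G r :=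
  if ∀ i, v i p.1.rep ≠ ⊤ then
    Series.monomial (fun i => (v i p.1.rep).toNat) (R₁.of p.2.choose) else 0

/-- `Q` is the earlier equivariant Poincaré series: the integral of `α t^{v(f)}` with respect to
the Euler characteristic over the projectivization of the union of the spaces of
equivariant functions. -/
def IsEarlierPoincareSeries (Q : Series G r) : Prop :=
  HasIntegral X.EquivEuler (X.equivMonomial v) Q

end VarietyGerm

end EquivPoincare

end

/-!
The proof rests on one ring homomorphism, `fixedSeries : K₀ → R₁(G)[[t]]`, which sends a
`(G, r)`-set to the sum of `α_x t^{w(x)}` over its fixed points. It is multiplicative because the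
fixed points of a product are the pairs of fixed points, and it kills `K₀''`. On `K₀'` it is
bijective: every element of `K₀'` is a difference of two sets with trivial action, which are
determined by their series because the characters of `G` are linearly independent
(`fixedSeries_injOn`), and every element of `R₁(G)` is a difference of two sums of characters
(`fixedSeries_surjOn`). Hence `Φ` is the restriction of `fixedSeries` to `K₀'`, the projection is
`Φ⁻¹ ∘ fixedSeries`, and `Φ ∘ proj = fixedSeries`. The complement `K₀''` splits off because every
`(G, r)`-set is the disjoint union of its fixed points and the rest.

For the two integrals, `fixedSeries (T_f)` is `α t^{v(f)}` if `f` is equivariant with respect to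
`α`, and it is `0` if `f` is not fixed by `G`. As `fixedSeries` is continuous, it can be applied to
the sum `∑ χ(T⁻¹(a)) a`, in which only the classes `a` of one-point sets survive. For such a class,
`T⁻¹(a)` consists of one-point orbits, and if it is cylindric, then so is the corresponding set of
equivariant functions, with the same Euler characteristic
(`VarietyGerm.OrbitEuler.equivEuler`). The point is that every jet has a lift with the same isotropy
group, obtained by averaging (`VarietyGerm.exists_projJet_eq`): it forces the jets that define
`T⁻¹(a)` to be fixed by `G`, and the quotient by `G` does not change the topology of a set of fixed
points. The same lifts show that the empty set has Euler characteristic `0`, and hence that the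
classes `a` not attained by `T` do not contribute.
-/

noncomputable section

namespace EquivPoincare

/-! ### Homomorphisms out of the Grothendieck ring -/

/-- A semiring homomorphism to a commutative ring extends to the Grothendieck ring. -/
def GrothendieckRing.liftRingHom {S : Type u} [CommSemiring S] {A : Type*} [CommRing A]
    (f : S →+* A) : GrothendieckRing S →+* A :=
  { GrothendieckRing.lift (f : S →+ A) with
    map_one' := (GrothendieckRing.lift_of (f : S →+ A) 1).trans f.map_one
    map_mul' := fun x y => by
      obtain ⟨a, b, rfl⟩ := GrothendieckRing.exists_eq x
      obtain ⟨c, d, rfl⟩ := GrothendieckRing.exists_eq y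
      simp [sub_mul, mul_sub, GrothendieckRing.of_mul_of, GrothendieckRing.lift_of] }

theorem GrothendieckRing.liftRingHom_of {S : Type u} [CommSemiring S] {A : Type*} [CommRing A]
    (f : S →+* A) (a : S) : GrothendieckRing.liftRingHom f (GrothendieckRing.of a) = f a :=
  GrothendieckRing.lift_of (f : S →+ A) a

variable {G : Type u} [Group G] {r : ℕ}

namespace GRSet

theorem cls_sum (A B : GRSet G r) : (A.sum B).cls = A.cls + B.cls :=
  (GrothendieckRing.of : GRClass G r →+ K₀ G r).map_add (Quotient.mk (GRSet.setoid G r) A)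
    (Quotient.mk (GRSet.setoid G r) B)

theorem cls_prod (A B : GRSet G r) : (A.prod B).cls = A.cls * B.cls :=
  (GrothendieckRing.of_mul_of (S := GRClass G r) (Quotient.mk (GRSet.setoid G r) A)
    (Quotient.mk (GRSet.setoid G r) B : GRClass G r)).symm

theorem cls_empty : (empty G r).cls = 0 :=
  map_zero (GrothendieckRing.of : GRClass G r →+ K₀ G r)

theorem cls_unit : (unit G r).cls = 1 := rfl

theorem cls_eq_of_isom {A B : GRSet G r} (h : Isom A B) : A.cls = B.cls :=
  congrArg GrothendieckRing.of (Quotient.sound (s := GRSet.setoid G r) h)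

end GRSet

theorem K₀.exists_eq_sub (x : K₀ G r) : ∃ A B : GRSet G r, x = A.cls - B.cls := by
  obtain ⟨a, b, rfl⟩ := GrothendieckRing.exists_eq x
  induction a using Quotient.inductionOn with | _ A
  induction b using Quotient.inductionOn with | _ B
  exact ⟨A, B, rfl⟩

/-! ### The series of fixed points -/

namespace GRSet

/-- The fixed points `x` of a `(G, r)`-set with `w x = d`. -/
def Fix (A : GRSet G r) (d : Fin r →₀ ℕ) : Type :=
  {x : A.carrier // (∀ g : G, g • x = x) ∧ A.w x = d}

instance (A : GRSet G r) (d : Fin r →₀ ℕ) : Finite (A.Fix d) :=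
  Set.Finite.to_subtype (s := {x : A.carrier | (∀ g : G, g • x = x) ∧ A.w x = d})
    ((A.locallyFinite d).subset fun _ h => h.2.le)

/-- The one-dimensional representation of `G` at a fixed point. -/
def char (A : GRSet G r) (x : A.carrier) (hx : ∀ g : G, g • x = x) : G →* ℂˣ :=
  (A.α x).comp ((MonoidHom.id G).codRestrict _ hx)

/-- The coefficient at `t^d` of the series of the fixed points of `A`. -/
def fixedCoeff (A : GRSet G r) (d : Fin r →₀ ℕ) : R₁ G :=
  ∑ᶠ x : A.Fix d, R₁.of (A.char x.1 x.2.1)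

theorem fixedCoeff_congr {A B : GRSet G r} (h : Isom A B) (d : Fin r →₀ ℕ) :
    A.fixedCoeff d = B.fixedCoeff d := by
  obtain ⟨e, h1, h2, h3⟩ := h
  let f : A.Fix d ≃ B.Fix d := e.subtypeEquiv fun x => by
    rw [h2]
    simp only [← h1, e.apply_eq_iff_eq]
  rw [fixedCoeff, fixedCoeff, ← finsum_comp_equiv f]
  refine finsum_congr fun x => congrArg R₁.of (MonoidHom.ext fun g => ?_)
  exact (h3 x.1 g (x.2.1 g) ((f x).2.1 g)).symm

theorem fixedCoeff_empty (d : Fin r →₀ ℕ) : (empty G r).fixedCoeff d = 0 := by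
  have : IsEmpty ((empty G r).Fix d) := ⟨fun x => (x.1 : Empty).elim⟩
  exact finsum_of_isEmpty _

theorem fixedCoeff_sum (A B : GRSet G r) (d : Fin r →₀ ℕ) :
    (A.sum B).fixedCoeff d = A.fixedCoeff d + B.fixedCoeff d := by
  let f : A.Fix d ⊕ B.Fix d ≃ (A.sum B).Fix d :=
    { toFun := Sum.elim (fun x => ⟨Sum.inl x.1, fun g => congrArg Sum.inl (x.2.1 g), x.2.2⟩)
        (fun y => ⟨Sum.inr y.1, fun g => congrArg Sum.inr (y.2.1 g), y.2.2⟩)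
      invFun := fun
        | ⟨Sum.inl x, h⟩ => Sum.inl ⟨x, fun g => Sum.inl_injective (h.1 g), h.2⟩
        | ⟨Sum.inr y, h⟩ => Sum.inr ⟨y, fun g => Sum.inr_injective (h.1 g), h.2⟩
      left_inv := by rintro (x | y) <;> rfl
      right_inv := by rintro ⟨x | y, h⟩ <;> rfl }
  have := Fintype.ofFinite (A.Fix d)
  have := Fintype.ofFinite (B.Fix d)
  rw [fixedCoeff, ← finsum_comp_equiv f, finsum_eq_sum_of_fintype, Fintype.sum_sum_type,
    fixedCoeff, fixedCoeff, finsum_eq_sum_of_fintype, finsum_eq_sum_of_fintype]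
  rfl

theorem fixedCoeff_prod (A B : GRSet G r) (d : Fin r →₀ ℕ) :
    (A.prod B).fixedCoeff d =
      ∑ p ∈ Finset.HasAntidiagonal.antidiagonal d, A.fixedCoeff p.1 * B.fixedCoeff p.2 := by
  let f : (Σ p : Finset.HasAntidiagonal.antidiagonal d, A.Fix p.1.1 × B.Fix p.1.2) ≃
      (A.prod B).Fix d :=
    { toFun := fun q => ⟨(q.2.1.1, q.2.2.1),
        fun g => Prod.ext (q.2.1.2.1 g) (q.2.2.2.1 g), by
          refine (congrArg₂ (· + ·) q.2.1.2.2 q.2.2.2.2).trans ?_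
          exact congrArg DFunLike.coe (Finset.HasAntidiagonal.mem_antidiagonal.1 q.1.2)⟩
      invFun := fun q => ⟨⟨(Finsupp.equivFunOnFinite.symm (A.w q.1.1),
          Finsupp.equivFunOnFinite.symm (B.w q.1.2)), Finset.HasAntidiagonal.mem_antidiagonal.2 <|
            DFunLike.coe_injective q.2.2⟩,
        ⟨q.1.1, fun g => congrArg Prod.fst (q.2.1 g), rfl⟩,
        ⟨q.1.2, fun g => congrArg Prod.snd (q.2.1 g), rfl⟩⟩
      left_inv := by
        rintro ⟨⟨⟨d₁, d₂⟩, hd⟩, ⟨x, hx, h₁⟩, ⟨y, hy, h₂⟩⟩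
        obtain rfl : Finsupp.equivFunOnFinite.symm (A.w x) = d₁ := DFunLike.coe_injective h₁
        obtain rfl : Finsupp.equivFunOnFinite.symm (B.w y) = d₂ := DFunLike.coe_injective h₂
        rfl
      right_inv := fun _ => rfl }
  have (c : Fin r →₀ ℕ) := Fintype.ofFinite (A.Fix c)
  have (c : Fin r →₀ ℕ) := Fintype.ofFinite (B.Fix c)
  rw [fixedCoeff, ← finsum_comp_equiv f, finsum_eq_sum_of_fintype, Fintype.sum_sigma,
    ← Finset.sum_coe_sort (Finset.HasAntidiagonal.antidiagonal d)
      fun p => A.fixedCoeff p.1 * B.fixedCoeff p.2]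
  refine Finset.sum_congr rfl fun p _ => ?_
  rw [fixedCoeff, fixedCoeff, finsum_eq_sum_of_fintype, finsum_eq_sum_of_fintype,
    Finset.sum_mul_sum, Fintype.sum_prod_type]
  rfl

theorem fixedCoeff_unit (d : Fin r →₀ ℕ) :
    (unit G r).fixedCoeff d = MvPowerSeries.coeff d (1 : MvPowerSeries (Fin r) (R₁ G)) := by
  classical
  rw [MvPowerSeries.coeff_one]
  split_ifs with h
  · subst h
    let x : (unit G r).Fix 0 := ⟨(), fun _ => rfl, rfl⟩
    have : Unique ((unit G r).Fix 0) := ⟨⟨x⟩, fun _ => rfl⟩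
    rw [fixedCoeff, finsum_unique]
    exact Subtype.ext (funext fun g => Units.val_one)
  · have : IsEmpty ((unit G r).Fix d) := ⟨fun x => h (DFunLike.coe_injective x.2.2.symm)⟩
    exact finsum_of_isEmpty _

/-- A point of weight `d` fixed by `G`, with the one-dimensional representation `α`. -/
def point (p : (Fin r → ℕ) × (G →* ℂˣ)) : GRSet G r where
  carrier := Unit
  action := { smul := fun _ x => x, one_smul := fun _ => rfl, mul_smul := fun _ _ _ => rfl }
  w := fun _ => p.1
  α := fun _ => p.2.comp (Subgroup.subtype _)
  α_conj := fun a _ g _ _ => by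
    change p.2 (a * g * a⁻¹) = p.2 g
    rw [map_mul, map_mul, map_inv, mul_right_comm, mul_inv_cancel, one_mul]
  locallyFinite := fun _ => Set.toFinite _

end GRSet

theorem Series.ext {s t : MvPowerSeries (Fin r) (R₁ G)}
    (h : ∀ d, MvPowerSeries.coeff d s = MvPowerSeries.coeff d t) : (s : Series G r) = t :=
  MvPowerSeries.ext h

namespace GRSet

/-- The sum of `α_x t^{w(x)}` over the fixed points `x` of a `(G, r)`-set. -/
def series (A : GRSet G r) : Series G r := A.fixedCoeff

theorem series_unit : (unit G r).series = 1 := Series.ext fixedCoeff_unit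

theorem series_empty : (empty G r).series = 0 := Series.ext fixedCoeff_empty

theorem series_sum (A B : GRSet G r) : (A.sum B).series = A.series + B.series :=
  Series.ext (A.fixedCoeff_sum B)

theorem series_prod (A B : GRSet G r) : (A.prod B).series = A.series * B.series := by
  have h : ∀ s t : MvPowerSeries (Fin r) (R₁ G), ∀ d, MvPowerSeries.coeff d (s * t) =
      ∑ p ∈ Finset.HasAntidiagonal.antidiagonal d, s p.1 * t p.2 :=
    fun s t d => MvPowerSeries.coeff_mul d s t
  exact Series.ext fun d => (A.fixedCoeff_prod B d).trans (h A.fixedCoeff B.fixedCoeff d).symm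

end GRSet

/-- The homomorphism `[A] ↦ A.series` on isomorphism classes. -/
def GRClass.series : GRClass G r →+* Series G r where
  toFun := Quotient.lift GRSet.series fun _ _ h => Series.ext (GRSet.fixedCoeff_congr h)
  map_one' := GRSet.series_unit
  map_mul' := fun a b => Quotient.inductionOn₂ a b GRSet.series_prod
  map_zero' := GRSet.series_empty
  map_add' := fun a b => Quotient.inductionOn₂ a b GRSet.series_sum

/-- The ring homomorphism from `K₀` to the power series that sends the class of `A` to the sum of
`α_x t^{w(x)}` over the fixed points `x` of `A`. -/
def fixedSeries : K₀ G r →+* Series G r := GrothendieckRing.liftRingHom GRClass.series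

theorem fixedSeries_cls (A : GRSet G r) : fixedSeries A.cls = A.series :=
  GrothendieckRing.liftRingHom_of _ _

theorem fixedSeries_eq_zero (A : GRSet G r) (hA : ∀ x : A.carrier, ∃ g : G, g • x ≠ x) :
    fixedSeries A.cls = 0 := by
  rw [fixedSeries_cls]
  refine Series.ext fun d => ?_
  have : IsEmpty (A.Fix d) := ⟨fun x => (hA x.1).elim fun g hg => hg (x.2.1 g)⟩
  exact finsum_of_isEmpty _

theorem GRSet.isom_point (A : GRSet G r) (x : A.carrier) (hx : ∀ g : G, g • x = x)
    (h : ∀ y, y = x) : Isom (point (A.w x, A.char x hx)) A := by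
  let e : Unit ≃ A.carrier := ⟨fun _ => x, fun _ => (), fun _ => rfl, fun y => (h y).symm⟩
  exact ⟨e, fun g _ => (hx g).symm, fun _ => rfl, fun _ _ _ _ => rfl⟩

theorem fixedSeries_point (p : (Fin r → ℕ) × (G →* ℂˣ)) :
    fixedSeries (GRSet.point p).cls = Series.monomial p.1 (R₁.of p.2) := by
  classical
  rw [fixedSeries_cls]
  refine Series.ext fun d => ?_
  refine Eq.trans (b := if d = Finsupp.equivFunOnFinite.symm p.1 then _ else 0) ?_
    (MvPowerSeries.coeff_monomial _ _ _).symm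
  split_ifs with hd
  · subst hd
    let _ : Unique ((GRSet.point p).Fix (Finsupp.equivFunOnFinite.symm p.1)) :=
      ⟨⟨(), fun _ => rfl, rfl⟩, fun _ => rfl⟩
    exact finsum_unique fun y : (GRSet.point p).Fix (Finsupp.equivFunOnFinite.symm p.1) =>
      R₁.of ((GRSet.point p).char y.1 y.2.1)
  · have : IsEmpty ((GRSet.point p).Fix d) := ⟨fun y => hd (DFunLike.coe_injective y.2.2.symm)⟩
    exact finsum_of_isEmpty _

theorem R₁.of_injective : Function.Injective (R₁.of : (G →* ℂˣ) → R₁ G) := fun _ _ h =>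
  MonoidHom.ext fun g => Units.ext (congrFun (congrArg Subtype.val h) g)

theorem R₁.of_ne_zero (α : G →* ℂˣ) : R₁.of α ≠ 0 := fun h =>
  (α 1).ne_zero (congrFun (congrArg Subtype.val h) 1)

theorem Series.monomial_ne_zero (p : (Fin r → ℕ) × (G →* ℂˣ)) :
    Series.monomial p.1 (R₁.of p.2) ≠ 0 := fun h =>
  R₁.of_ne_zero p.2 ((MvPowerSeries.coeff_monomial_same _ _).symm.trans
    (congrArg (MvPowerSeries.coeff (Finsupp.equivFunOnFinite.symm p.1)) h))

theorem Series.monomial_of_injective :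
    Function.Injective fun p : (Fin r → ℕ) × (G →* ℂˣ) => Series.monomial p.1 (R₁.of p.2) := by
  classical
  rintro p q h
  have h' := congrArg (MvPowerSeries.coeff (Finsupp.equivFunOnFinite.symm p.1)) h
  have h'' := ((MvPowerSeries.coeff_monomial_same _ _).symm.trans h').trans
    (MvPowerSeries.coeff_monomial _ _ _)
  split_ifs at h'' with hd
  · exact Prod.ext (Finsupp.equivFunOnFinite.symm.injective hd) (R₁.of_injective h'')
  · exact absurd h'' (R₁.of_ne_zero p.2)

/-! ### The isomorphism between `K₀'` and the ring of power series -/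

theorem R₁.exists_eq_sum_sub_sum (x : R₁ G) : ∃ P N : List (G →* ℂˣ),
    x = (P.map R₁.of).sum - (N.map R₁.of).sum := by
  let χ : (G →* ℂˣ) →* (G → ℂ) :=
    { toFun := fun α g => (α g : ℂ)
      map_one' := rfl
      map_mul' := fun _ _ => funext fun g => Units.val_mul _ _ }
  obtain ⟨x, hx⟩ := x
  -- The characters form a monoid, so that the subring they generate is their additive span.
  have hx' : x ∈ AddSubgroup.closure (Set.range χ) := by
    have h := Subring.mem_closure_iff.1 hx
    change x ∈ AddSubgroup.closure (Submonoid.closure (Set.range χ) : Set (G → ℂ)) at h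
    rwa [← MonoidHom.coe_mrange, Submonoid.closure_eq, MonoidHom.coe_mrange] at h
  suffices h : ∃ P N : List (G →* ℂˣ), x = (P.map χ).sum - (N.map χ).sum by
    obtain ⟨P, N, h⟩ := h
    have hs (L : List (G →* ℂˣ)) : ((L.map R₁.of).sum : R₁ G).1 = (L.map χ).sum := by
      change (R₁ G).subtype _ = _
      rw [map_list_sum, List.map_map]
      rfl
    exact ⟨P, N, Subtype.ext (h.trans (by rw [← hs, ← hs]; rfl))⟩
  clear hx
  induction hx' using AddSubgroup.closure_induction with
  | mem x hx =>
    obtain ⟨α, rfl⟩ := hx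
    exact ⟨[α], [], by simp⟩
  | zero => exact ⟨[], [], by simp⟩
  | add x y _ _ ihx ihy =>
    obtain ⟨P, N, rfl⟩ := ihx
    obtain ⟨P', N', rfl⟩ := ihy
    refine ⟨P ++ P', N ++ N', ?_⟩
    rw [List.map_append, List.map_append, List.sum_append, List.sum_append]
    abel
  | neg x _ ih =>
    obtain ⟨P, N, rfl⟩ := ih
    exact ⟨N, P, neg_sub _ _⟩

/-- The differences of classes of sets with trivial action already form a subring. -/
theorem K₀'.exists_eq_sub {x : K₀ G r} (hx : x ∈ K₀' G r) : ∃ A B : GRSet G r,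
    (∀ (g : G) (x : A.carrier), g • x = x) ∧ (∀ (g : G) (x : B.carrier), g • x = x) ∧
      x = A.cls - B.cls := by
  induction hx using Subring.closure_induction with
  | mem x hx =>
    obtain ⟨A, hA, rfl⟩ := hx
    exact ⟨A, GRSet.empty G r, hA, fun _ x => Empty.elim x, by rw [GRSet.cls_empty, sub_zero]⟩
  | zero => exact ⟨GRSet.empty G r, GRSet.empty G r, fun _ x => Empty.elim x,
      fun _ x => Empty.elim x, (sub_self (GRSet.empty G r).cls).symm⟩
  | one => exact ⟨GRSet.unit G r, GRSet.empty G r, fun _ _ => rfl, fun _ x => Empty.elim x, by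
      rw [GRSet.cls_empty, sub_zero, GRSet.cls_unit]⟩
  | add x y _ _ ihx ihy =>
    obtain ⟨A, B, hA, hB, rfl⟩ := ihx
    obtain ⟨C, D, hC, hD, rfl⟩ := ihy
    refine ⟨A.sum C, B.sum D, ?_, ?_, ?_⟩
    · rintro g (x | x)
      · exact congrArg Sum.inl (hA g x)
      · exact congrArg Sum.inr (hC g x)
    · rintro g (x | x)
      · exact congrArg Sum.inl (hB g x)
      · exact congrArg Sum.inr (hD g x)
    · rw [GRSet.cls_sum, GRSet.cls_sum]
      abel
  | neg x _ ih =>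
    obtain ⟨A, B, hA, hB, rfl⟩ := ih
    exact ⟨B, A, hB, hA, neg_sub _ _⟩
  | mul x y _ _ ihx ihy =>
    obtain ⟨A, B, hA, hB, rfl⟩ := ihx
    obtain ⟨C, D, hC, hD, rfl⟩ := ihy
    refine ⟨(A.prod C).sum (B.prod D), (A.prod D).sum (B.prod C), ?_, ?_, ?_⟩
    · rintro g (⟨x, y⟩ | ⟨x, y⟩)
      · exact congrArg Sum.inl (Prod.ext (hA g x) (hC g y))
      · exact congrArg Sum.inr (Prod.ext (hB g x) (hD g y))
    · rintro g (⟨x, y⟩ | ⟨x, y⟩)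
      · exact congrArg Sum.inl (Prod.ext (hA g x) (hD g y))
      · exact congrArg Sum.inr (Prod.ext (hB g x) (hC g y))
    · simp only [GRSet.cls_sum, GRSet.cls_prod]
      ring

/-- The `(G, r)`-set with trivial action whose points of weight `d` are the positions in the list
`L d`, with the one-dimensional representations listed there. -/
def GRSet.ofLists (L : (Fin r → ℕ) → List (G →* ℂˣ)) : GRSet G r where
  carrier := Σ d, Fin (L d).length
  action := { smul := fun _ x => x, one_smul := fun _ => rfl, mul_smul := fun _ _ _ => rfl }
  w := Sigma.fst
  α := fun x => ((L x.1).get x.2).comp (Subgroup.subtype _)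
  α_conj := fun a x g _ _ => by
    change (L x.1).get x.2 (a * g * a⁻¹) = (L x.1).get x.2 g
    rw [map_mul, map_mul, map_inv, mul_right_comm, mul_inv_cancel, one_mul]
  locallyFinite := fun W => by
    have : Finite (Σ d : Set.Iic W, Fin (L d.1).length) := inferInstance
    refine (Set.finite_range fun x : Σ d : Set.Iic W, Fin (L d.1).length =>
      (⟨x.1.1, x.2⟩ : Σ d, Fin (L d).length)).subset ?_
    rintro ⟨d, i⟩ h
    exact ⟨⟨⟨d, h⟩, i⟩, rfl⟩

theorem GRSet.fixedCoeff_ofLists (L : (Fin r → ℕ) → List (G →* ℂˣ)) (d : Fin r →₀ ℕ) :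
    (GRSet.ofLists L).fixedCoeff d = ((L d).map R₁.of).sum := by
  let f : Fin (L d).length ≃ (GRSet.ofLists L).Fix d :=
    { toFun := fun i => ⟨⟨d, i⟩, fun _ => rfl, rfl⟩
      invFun := fun x => ⟨x.1.2.1, x.1.2.2.trans_eq (congrArg (fun d => (L d).length) x.2.2)⟩
      left_inv := fun _ => rfl
      right_inv := by
        rintro ⟨⟨d', i⟩, h, h'⟩
        obtain rfl : d' = d := h'
        rfl }
  rw [fixedCoeff, ← finsum_comp_equiv f, finsum_eq_sum_of_fintype,
    ← Fin.sum_univ_fun_getElem]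
  rfl

/-- By the linear independence of characters, the sum of a finite family of one-dimensional
representations determines the multiplicity of each of them. -/
theorem card_fiber_eq_of_sum_eq {X Y : Type} [Finite X] [Finite Y]
    (a : X → G →* ℂˣ) (b : Y → G →* ℂˣ)
    (h : ∑ᶠ x, R₁.of (a x) = ∑ᶠ y, R₁.of (b y)) (α : G →* ℂˣ) :
    Nat.card {x // a x = α} = Nat.card {y // b y = α} := by
  classical
  have := Fintype.ofFinite X
  have := Fintype.ofFinite Y
  let c : (G →* ℂˣ) → G →* ℂ := fun β => (Units.coeHom ℂ).comp β
  have hc : Function.Injective c := fun β γ h =>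
    MonoidHom.ext fun g => Units.ext (DFunLike.congr_fun h g)
  have key : ∀ {Z : Type} [Fintype Z] (u : Z → G →* ℂˣ),
      Finsupp.linearCombination ℂ (fun f : G →* ℂ => (f : G → ℂ))
        (∑ z, Finsupp.single (c (u z)) 1) = (∑ᶠ z, R₁.of (u z) : R₁ G).1 := by
    intro Z _ u
    rw [finsum_eq_sum_of_fintype, map_sum]
    change _ = (R₁ G).subtype _
    rw [map_sum]
    refine Finset.sum_congr rfl fun z _ => ?_
    rw [Finsupp.linearCombination_single, one_smul]
    rfl
  have hs : ∑ x, Finsupp.single (c (a x)) (1 : ℂ) = ∑ y, Finsupp.single (c (b y)) 1 :=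
    linearIndependent_monoidHom G ℂ (by rw [key, key, h])
  have count : ∀ {Z : Type} [Fintype Z] (u : Z → G →* ℂˣ),
      (∑ z, Finsupp.single (c (u z)) (1 : ℂ)) (c α) = Nat.card {z // u z = α} := by
    intro Z _ u
    simp only [Finsupp.finsetSum_apply, Finsupp.single_apply, hc.eq_iff]
    rw [Finset.sum_boole, Nat.card_eq_fintype_card, Fintype.card_subtype]
  have h' := DFunLike.congr_fun hs (c α)
  rw [count, count] at h'
  exact_mod_cast h'

theorem GRSet.isom_of_fixedCoeff_eq {A B : GRSet G r} (hA : ∀ (g : G) (x : A.carrier), g • x = x)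
    (hB : ∀ (g : G) (x : B.carrier), g • x = x) (h : A.fixedCoeff = B.fixedCoeff) : Isom A B := by
  have key : ∀ p : (Fin r → ℕ) × (G →* ℂˣ),
      Nonempty ({x // (A.w x, A.char x fun g => hA g x) = p} ≃
        {y // (B.w y, B.char y fun g => hB g y) = p}) := by
    rintro ⟨d, α⟩
    let d' := Finsupp.equivFunOnFinite.symm d
    have hcard := card_fiber_eq_of_sum_eq (fun x : A.Fix d' => A.char x.1 x.2.1)
      (fun y : B.Fix d' => B.char y.1 y.2.1) (congrFun h d') α
    have fiber : ∀ (C : GRSet G r) (hC : ∀ (g : G) (x : C.carrier), g • x = x),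
        Nonempty ({x : C.Fix d' // C.char x.1 x.2.1 = α} ≃
          {x // (C.w x, C.char x fun g => hC g x) = (d, α)}) := fun C hC =>
      ⟨{toFun := fun x => ⟨x.1.1, Prod.ext x.1.2.2 x.2⟩
        invFun := fun x => ⟨⟨x.1, fun g => hC g x.1, congrArg Prod.fst x.2⟩, congrArg Prod.snd x.2⟩
        left_inv := fun _ => rfl
        right_inv := fun _ => rfl }⟩
    obtain ⟨eA⟩ := fiber A hA
    obtain ⟨eB⟩ := fiber B hB
    exact ⟨eA.symm.trans ((Finite.equivFinOfCardEq hcard).trans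
      ((Finite.equivFin _).symm.trans eB))⟩
  let e := fun p => (key p).some
  have he := fun x => Equiv.ofFiberEquiv_map e x
  refine ⟨Equiv.ofFiberEquiv e, fun g x => by rw [hA, hB], fun x => congrArg Prod.fst (he x),
    fun x g _ _ => DFunLike.congr_fun (congrArg Prod.snd (he x)) g⟩

theorem fixedSeries_injOn : Set.InjOn (fixedSeries : K₀ G r → Series G r) (K₀' G r) := by
  intro x hx y hy hxy
  obtain ⟨A, B, hA, hB, h⟩ := K₀'.exists_eq_sub (sub_mem hx hy)
  have h0 : fixedSeries (A.cls - B.cls) = 0 := by rw [← h, map_sub, hxy, sub_self]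
  rw [map_sub, sub_eq_zero, fixedSeries_cls, fixedSeries_cls] at h0
  rw [GRSet.cls_eq_of_isom (GRSet.isom_of_fixedCoeff_eq hA hB h0), sub_self] at h
  exact sub_eq_zero.1 h

theorem fixedSeries_surjOn (s : Series G r) : ∃ x ∈ K₀' G r, fixedSeries x = s := by
  -- The negative parts of all the coefficients are collected in one second `(G, r)`-set.
  choose P N h using fun d : Fin r → ℕ => R₁.exists_eq_sum_sub_sum (Series.coeff d s)
  refine ⟨(GRSet.ofLists P).cls - (GRSet.ofLists N).cls,
    sub_mem (GRSet.cls_mem _ fun _ _ => rfl) (GRSet.cls_mem _ fun _ _ => rfl), ?_⟩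
  rw [map_sub, fixedSeries_cls, fixedSeries_cls]
  refine Series.ext fun d => ?_
  refine (congrArg₂ (· - ·) (GRSet.fixedCoeff_ofLists P d)
    (GRSet.fixedCoeff_ofLists N d)).trans ((h d).symm.trans ?_)
  exact congrArg s (DFunLike.coe_injective rfl)

/-- The isomorphism `Φ` of `K₀'` with the ring of power series. -/
def K₀'.equivSeries (G : Type u) [Group G] (r : ℕ) : K₀' G r ≃+* Series G r :=
  RingEquiv.ofBijective (fixedSeries.comp (K₀' G r).subtype)
    ⟨fun x y h => Subtype.ext (fixedSeries_injOn x.2 y.2 h), fun s => by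
      obtain ⟨x, hx, h⟩ := fixedSeries_surjOn s
      exact ⟨⟨x, hx⟩, h⟩⟩

theorem K₀'.equivSeries_apply (x : K₀' G r) : K₀'.equivSeries G r x = fixedSeries x.1 := rfl

theorem K₀'.coeff_equivSeries (A : GRSet G r) (hA : ∀ (g : G) (x : A.carrier), g • x = x)
    (w : Fin r → ℕ) (g : G) :
    (Series.coeff w (K₀'.equivSeries G r ⟨A.cls, A.cls_mem hA⟩) : G → ℂ) g =
      ∑ᶠ x : {x : A.carrier // A.w x = w}, (A.α x.1 ⟨g, hA g x.1⟩ : ℂ) := by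
  let d := Finsupp.equivFunOnFinite.symm w
  let f : {x : A.carrier // A.w x = w} ≃ A.Fix d :=
    { toFun := fun x => ⟨x.1, fun g => hA g x.1, x.2⟩
      invFun := fun x => ⟨x.1, x.2.2⟩
      left_inv := fun _ => rfl
      right_inv := fun _ => rfl }
  let ev : R₁ G →+* ℂ := (Pi.evalRingHom (fun _ => ℂ) g).comp (R₁ G).subtype
  have h : Series.coeff w (fixedSeries A.cls) = A.fixedCoeff d :=
    congrFun (fixedSeries_cls A) d
  rw [equivSeries_apply, h, ← finsum_comp_equiv f.symm]
  exact ev.toAddMonoidHom.map_finsum (Set.toFinite _)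

/-! ### The decomposition of `K₀` -/

/-- The projection of `K₀` to `K₀'`: it forgets the points that are not fixed by `G`. -/
def K₀.proj (G : Type u) [Group G] (r : ℕ) : K₀ G r →+* K₀' G r :=
  (K₀'.equivSeries G r).symm.toRingHom.comp fixedSeries

theorem K₀.equivSeries_proj (x : K₀ G r) : K₀'.equivSeries G r (K₀.proj G r x) = fixedSeries x :=
  (K₀'.equivSeries G r).apply_symm_apply _

theorem K₀.proj_coe (x : K₀' G r) : K₀.proj G r x = x :=
  (K₀'.equivSeries G r).symm_apply_apply x

theorem fixedSeries_of_mem_K₀'' {y : K₀ G r} (hy : y ∈ K₀'' G r) : fixedSeries y = 0 := by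
  induction hy using NonUnitalSubring.closure_induction with
  | mem y hy =>
    obtain ⟨A, hA, rfl⟩ := hy
    exact fixedSeries_eq_zero A hA
  | zero => exact map_zero _
  | add x y _ _ hx hy => rw [map_add, hx, hy, add_zero]
  | neg x _ hx => rw [map_neg, hx, neg_zero]
  | mul x y _ _ hx hy => rw [map_mul, hx, zero_mul]

theorem K₀.proj_of_mem_K₀'' {y : K₀ G r} (hy : y ∈ K₀'' G r) : K₀.proj G r y = 0 :=
  (congrArg _ (fixedSeries_of_mem_K₀'' hy)).trans (map_zero (K₀'.equivSeries G r).symm)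

theorem K₀''.mul_mem_left (x : K₀ G r) {y : K₀ G r} (hy : y ∈ K₀'' G r) : x * y ∈ K₀'' G r := by
  induction hy using NonUnitalSubring.closure_induction with
  | mem y hy =>
    obtain ⟨A, hA, rfl⟩ := hy
    obtain ⟨B, C, rfl⟩ := K₀.exists_eq_sub x
    have key : ∀ D : GRSet G r, (D.prod A).cls ∈ K₀'' G r := fun D =>
      NonUnitalSubring.subset_closure ⟨D.prod A, fun x => (hA x.2).imp fun g hg h =>
        hg (congrArg Prod.snd h), rfl⟩
    rw [sub_mul, ← GRSet.cls_prod, ← GRSet.cls_prod]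
    exact sub_mem (key B) (key C)
  | zero => rw [mul_zero]; exact zero_mem _
  | add _ _ _ _ hx hy => rw [mul_add]; exact add_mem hx hy
  | neg _ _ hx => rw [mul_neg]; exact neg_mem hx
  | mul _ z _ hz hx _ => rw [← mul_assoc]; exact mul_mem hx hz

namespace GRSet

/-- An invariant subset of a `(G, r)`-set, with the restricted structure. -/
def restrict (A : GRSet G r) (S : SubMulAction G A.carrier) : GRSet G r where
  carrier := S
  w := fun x => A.w x.1
  α := fun x => (A.α x.1).comp (Subgroup.inclusion fun _ h => congrArg Subtype.val h)
  α_conj := fun a x g hg hg' =>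
    A.α_conj a x.1 g (congrArg Subtype.val hg) (congrArg Subtype.val hg')
  locallyFinite := fun W => (A.locallyFinite W).preimage Subtype.val_injective.injOn

/-- The invariant subset of the fixed points. -/
def fixedPart (A : GRSet G r) : SubMulAction G A.carrier where
  carrier := {x | ∀ g : G, g • x = x}
  smul_mem' := fun c x hx g => by
    have hx' : ∀ g : G, g • x = x := hx
    rw [hx', hx']

/-- The invariant subset of the points that are not fixed. -/
def movingPart (A : GRSet G r) : SubMulAction G A.carrier where
  carrier := {x | ∃ g : G, g • x ≠ x}
  smul_mem' := fun c x ⟨g, hg⟩ => ⟨c * g * c⁻¹, fun h => hg <| by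
    rwa [mul_smul, mul_smul, inv_smul_smul, smul_left_cancel_iff] at h⟩

theorem isom_sum_restrict (A : GRSet G r) :
    Isom ((A.restrict A.fixedPart).sum (A.restrict A.movingPart)) A := by
  classical
  have hcompl : ∀ x, x ∈ A.movingPart ↔ x ∉ A.fixedPart := fun x =>
    (not_forall (p := fun g : G => g • x = x)).symm
  let e : A.fixedPart ⊕ A.movingPart ≃ A.carrier :=
    (Equiv.sumCongr (Equiv.refl _) (Equiv.subtypeEquivRight hcompl)).trans
      (Equiv.sumCompl (· ∈ A.fixedPart))
  refine ⟨e, ?_, ?_, ?_⟩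
  · rintro g (x | x) <;> rfl
  · rintro (x | x) <;> rfl
  · rintro (x | x) g h h' <;> rfl

end GRSet

theorem K₀.isCompl (G : Type u) [Group G] (r : ℕ) :
    IsCompl (K₀' G r).toAddSubgroup (K₀'' G r).toAddSubgroup := by
  refine isCompl_iff.2 ⟨AddSubgroup.disjoint_def.2 fun {x} hx hx' => ?_, codisjoint_iff.2 ?_⟩
  · exact fixedSeries_injOn hx (zero_mem (K₀' G r))
      ((fixedSeries_of_mem_K₀'' hx').trans (map_zero _).symm)
  · refine eq_top_iff.2 fun x _ => ?_
    have key : ∀ A : GRSet G r, A.cls ∈ (K₀' G r).toAddSubgroup ⊔ (K₀'' G r).toAddSubgroup := by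
      intro A
      rw [← GRSet.cls_eq_of_isom A.isom_sum_restrict, GRSet.cls_sum]
      refine AddSubgroup.add_mem_sup ?_ ?_
      · exact GRSet.cls_mem _ fun g x => Subtype.ext (x.2 g)
      · exact NonUnitalSubring.subset_closure ⟨A.restrict A.movingPart, fun x => x.2.imp
          fun g hg h => hg (congrArg Subtype.val h), rfl⟩
    obtain ⟨A, B, rfl⟩ := K₀.exists_eq_sub x
    exact sub_mem (key A) (key B)

/-! ### Continuity of the series of fixed points -/

instance : T2Space (Series G r) := by
  let _ : TopologicalSpace (R₁ G) := ⊥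
  have : DiscreteTopology (R₁ G) := ⟨rfl⟩
  exact MvPowerSeries.WithPiTopology.instT2Space (σ := Fin r) (R := R₁ G)

/-- A set without points `x` such that `w x ≤ d` contributes nothing to the coefficient at `t^d`. -/
theorem fixedSeries_apply_of_mem_tail (d : Fin r →₀ ℕ) {y : K₀ G r} (hy : y ∈ K₀.tail G r d) :
    MvPowerSeries.coeff d (fixedSeries y : MvPowerSeries (Fin r) (R₁ G)) = 0 := by
  let φ : K₀ G r →+ R₁ G :=
    ((MvPowerSeries.coeff d : MvPowerSeries (Fin r) (R₁ G) →ₗ[R₁ G] R₁ G).toAddMonoidHom).comp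
      (fixedSeries : K₀ G r →+* Series G r).toAddMonoidHom
  suffices h : K₀.tail G r d ≤ φ.ker from h hy
  refine (AddSubgroup.closure_le _).2 ?_
  rintro y ⟨A, hA, rfl⟩
  have : IsEmpty (A.Fix d) := ⟨fun x => hA x.1 x.2.2.le⟩
  exact (congrFun (fixedSeries_cls A) d).trans (finsum_of_isEmpty _)

theorem continuous_fixedSeries : Continuous (fixedSeries : K₀ G r → Series G r) := by
  let _ : TopologicalSpace (R₁ G) := ⊥
  refine continuous_pi (A := fun _ : Fin r →₀ ℕ => R₁ G) fun d => ?_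
  refine ⟨fun U _ => isOpen_iff_forall_mem_open.2 fun y hy => ?_⟩
  refine ⟨{z | z - y ∈ K₀.tail G r d}, fun z hz => ?_,
    TopologicalSpace.isOpen_generateFrom_of_mem ⟨y, d, rfl⟩, ?_⟩
  · have h := fixedSeries_apply_of_mem_tail d hz
    rw [map_sub] at h
    have h' : (fixedSeries z : Series G r) d = (fixedSeries y : Series G r) d := sub_eq_zero.1 h
    change (fixedSeries z : Series G r) d ∈ U
    rw [h']
    exact hy
  · change y - y ∈ K₀.tail G r d
    rw [sub_self]
    exact zero_mem _

/-! ### The Euler characteristic -/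

theorem eulerChar_of_isEmpty (Y : Type) [TopologicalSpace Y] [IsEmpty Y] : eulerChar Y = 0 := by
  refine (finsum_congr fun n => ?_).trans finsum_zero
  have : IsEmpty (TopCat.of Y) := ‹IsEmpty Y›
  have : TotallyDisconnectedSpace (TopCat.of Y) := inferInstance
  have hz : CategoryTheory.Limits.IsZero
      (((AlgebraicTopology.singularHomologyFunctor (ModuleCat.{0} ℚ) n).obj
        (ModuleCat.of ℚ ℚ)).obj (TopCat.of Y)) := by
    rcases eq_or_ne n 0 with rfl | hn
    · refine CategoryTheory.Limits.IsZero.of_iso ?_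
        (AlgebraicTopology.singularHomologyFunctorZeroOfTotallyDisconnectedSpace
          (ModuleCat.{0} ℚ) (ModuleCat.of ℚ ℚ) (TopCat.of Y))
      exact (CategoryTheory.Limits.IsZero.iff_id_eq_zero _).2
        (CategoryTheory.Limits.Sigma.hom_ext _ _ fun y => isEmptyElim y)
    · exact AlgebraicTopology.isZero_singularHomologyFunctor_of_totallyDisconnectedSpace _ _ _ _ hn
  have := ModuleCat.subsingleton_of_isZero hz
  rw [Module.finrank_zero_of_subsingleton]
  simp

theorem eulerChar_congr {Y Z : Type} [TopologicalSpace Y] [TopologicalSpace Z] (e : Y ≃ₜ Z) :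
    eulerChar Y = eulerChar Z := by
  refine finsum_congr fun n => ?_
  have i := ((AlgebraicTopology.singularHomologyFunctor (ModuleCat.{0} ℚ) n).obj
      (ModuleCat.of ℚ ℚ)).mapIso (TopCat.isoOfHomeo (X := TopCat.of Y) (Y := TopCat.of Z) e)
  rw [i.toLinearEquiv.finrank_eq]

theorem isConstructibleSubset_empty (M : Type) [AddCommGroup M] [Module ℂ M] :
    IsConstructibleSubset (∅ : Set (ℙ ℂ M)) :=
  BooleanSubalgebra.bot_mem

section Isotropy

variable {E : Type} [AddCommGroup E] [Module ℂ E] [DistribMulAction G E] [SMulCommClass G ℂ E]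

instance : ContinuousConstSMul G (ℙ ℂ E) where
  continuous_const_smul g := by
    let _ : TopologicalSpace E := moduleTopology ℂ E
    have : IsModuleTopology ℂ E := ⟨rfl⟩
    have : ContinuousAdd E := IsModuleTopology.toContinuousAdd ℂ E
    have hg : Continuous fun v : E => g • v :=
      IsModuleTopology.continuous_of_linearMap (DistribSMul.toLinearMap ℂ E g)
    refine continuous_coinduced_dom.2 ?_
    have hr : Continuous fun v : {v : E // v ≠ 0} =>
        (⟨g • v.1, (smul_ne_zero_iff_ne g).mpr v.2⟩ : {v : E // v ≠ 0}) :=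
      (hg.comp continuous_subtype_val).subtype_mk _
    exact continuous_coinduced_rng.comp hr

/-- The quotient by `G` does not change the topology of a set of fixed points. -/
theorem eulerChar_preimage_of_fixed (Z : Set (MulAction.orbitRel.Quotient G (ℙ ℂ E)))
    (hZ : ∀ q : ℙ ℂ E, (Quotient.mk'' q : MulAction.orbitRel.Quotient G (ℙ ℂ E)) ∈ Z →
      ∀ g : G, g • q = q) :
    eulerChar {q : ℙ ℂ E | (Quotient.mk'' q : MulAction.orbitRel.Quotient G (ℙ ℂ E)) ∈ Z} =
      eulerChar Z := by
  have ho := MulAction.isOpenQuotientMap_quotientMk (Γ := G) (T := ℙ ℂ E)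
  let f : ℙ ℂ E → MulAction.orbitRel.Quotient G (ℙ ℂ E) := Quotient.mk''
  have hf : Function.Bijective (Z.restrictPreimage f) := by
    refine ⟨fun x y h => ?_, Set.restrictPreimage_surjective Z ho.surjective⟩
    obtain ⟨g, hg⟩ := Quotient.exact (congrArg Subtype.val h)
    exact Subtype.ext (hg.symm.trans (hZ _ y.2 g))
  exact eulerChar_congr (Y := f ⁻¹' Z) (Z := Z)
    ((Equiv.ofBijective _ hf).toHomeomorphOfContinuousOpen
      (ho.continuous.restrictPreimage) (ho.isOpenMap.restrictPreimage Z))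

end Isotropy

namespace VarietyGerm

variable (X : VarietyGerm G) (v : Fin r → X.O → ℕ∞)

/-! ### Jets and isotropy groups -/

theorem projJet_mk (k : ℕ) (f : X.O) (hf : f ≠ 0) (hj : X.jet k f ≠ 0) :
    X.projJet k (Projectivization.mk ℂ f hf) = some (Projectivization.mk ℂ (X.jet k f) hj) := by
  obtain ⟨a, ha⟩ := Projectivization.exists_smul_eq_mk_rep ℂ f hf
  have hr : X.jet k (Projectivization.mk ℂ f hf).rep = a • X.jet k f := by
    rw [← ha, Units.smul_def, Units.smul_def, map_smul]
  have h0 : X.jet k (Projectivization.mk ℂ f hf).rep ≠ 0 := by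
    rw [hr]
    exact (smul_ne_zero_iff_ne a).2 hj
  rw [projJet, dif_pos h0, Option.some_inj]
  exact (Projectivization.mk_eq_mk_iff _ _ _ _ _).2 ⟨a, hr.symm⟩

theorem projJet_smul (k : ℕ) {p : ℙ ℂ X.O} {q : ℙ ℂ (X.J k)} (h : X.projJet k p = some q) (g : G) :
    X.projJet k (g • p) = some (g • q) := by
  by_cases h0 : X.jet k p.rep ≠ 0
  · rw [projJet, dif_pos h0, Option.some_inj] at h
    have hg : X.jet k (g • p.rep) ≠ 0 := by
      rw [← X.jetAct_jet]
      exact (smul_ne_zero_iff_ne g).2 h0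
    have := X.projJet_mk k (g • p.rep) ((smul_ne_zero_iff_ne g).2 p.rep_nonzero) hg
    rw [← h]
    conv_lhs => rw [← p.mk_rep]
    exact this
  · rw [projJet, dif_neg h0] at h
    exact absurd h (by simp)

theorem stabilizer_le_of_projJet (k : ℕ) {p : ℙ ℂ X.O} {q : ℙ ℂ (X.J k)}
    (h : X.projJet k p = some q) : MulAction.stabilizer G p ≤ MulAction.stabilizer G q := by
  intro g hg
  have h' := X.projJet_smul k h g
  rw [MulAction.mem_stabilizer_iff.1 hg, h, Option.some_inj] at h'
  exact h'.symm

/-- Averaging a lift of a jet over the isotropy group of the jet, twisted by its character, gives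
a lift with the same isotropy group. -/
theorem exists_projJet_eq [Finite G] (k : ℕ) (q : ℙ ℂ (X.J k)) :
    ∃ p : ℙ ℂ X.O, X.projJet k p = some q ∧
      MulAction.stabilizer G p = MulAction.stabilizer G q := by
  classical
  have := Fintype.ofFinite (MulAction.stabilizer G q)
  let c : MulAction.stabilizer G q →* ℂˣ := isotropyRep q
  obtain ⟨f, hf⟩ := X.jet_surjective k q.rep
  let F : X.O := ∑ h : MulAction.stabilizer G q, ((c h)⁻¹ : ℂˣ) • ((h : G) • f)
  have hN : (Fintype.card (MulAction.stabilizer G q) : ℂ) ≠ 0 :=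
    Nat.cast_ne_zero.2 Fintype.card_ne_zero
  have hjet : X.jet k F = (Fintype.card (MulAction.stabilizer G q) : ℂ) • q.rep := by
    rw [map_sum, Finset.sum_congr rfl (g := fun _ => q.rep), Finset.sum_const, Finset.card_univ,
      Nat.cast_smul_eq_nsmul]
    intro h _
    have hq : (h : G) • q.rep = c h • q.rep := isotropyRep_spec q h q.rep_nonzero q.mk_rep
    rw [Units.smul_def, map_smul, ← X.jetAct_jet, hf]
    change _ • ((h : G) • q.rep) = _
    rw [hq, ← Units.smul_def, inv_smul_smul]
  have hj0 : X.jet k F ≠ 0 := by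
    rw [hjet]
    exact smul_ne_zero hN q.rep_nonzero
  have hF0 : F ≠ 0 := fun h => hj0 (by rw [h, map_zero])
  have hmk : X.projJet k (Projectivization.mk ℂ F hF0) = some q := by
    rw [X.projJet_mk k F hF0 hj0, Option.some_inj]
    conv_rhs => rw [← q.mk_rep]
    exact (Projectivization.mk_eq_mk_iff' _ _ _ _ _).2 ⟨_, hjet.symm⟩
  refine ⟨_, hmk, le_antisymm (X.stabilizer_le_of_projJet k hmk) fun g hg => ?_⟩
  have hact : g • F = (c ⟨g, hg⟩ : ℂ) • F := by
    rw [Finset.smul_sum, Finset.smul_sum]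
    refine Fintype.sum_equiv (Equiv.mulLeft ⟨g, hg⟩) _ _ fun h => ?_
    rw [Equiv.coe_mulLeft, map_mul, Units.smul_def, Units.smul_def, smul_comm, smul_smul,
      smul_smul, Subgroup.coe_mul, mul_inv, Units.val_mul, Units.mul_inv_cancel_left]
  rw [MulAction.mem_stabilizer_iff, Projectivization.smul_mk]
  exact (Projectivization.mk_eq_mk_iff' _ _ _ _ _).2 ⟨_, hact.symm⟩

/-- A point lies in the projectivization of the spaces of equivariant functions if and only if it
is fixed by `G`. -/
theorem exists_mem_equivariantFunctions_iff (p : ℙ ℂ X.O) :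
    (∃ α : G →* ℂˣ, p.rep ∈ X.equivariantFunctions α) ↔ ∀ g : G, g • p = p := by
  constructor
  · rintro ⟨α, hα⟩ g
    have hg : g • p.rep = (α g : ℂ) • p.rep := hα g
    conv_lhs => rw [← p.mk_rep]
    conv_rhs => rw [← p.mk_rep]
    rw [Projectivization.smul_mk]
    exact (Projectivization.mk_eq_mk_iff' _ _ _ _ _).2 ⟨_, hg.symm⟩
  · intro h
    exact ⟨(isotropyRep p).comp ((MonoidHom.id G).codRestrict _ h), fun g =>
      isotropyRep_spec p ⟨g, h g⟩ p.rep_nonzero p.mk_rep⟩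

theorem ProjEquiv.smul_eq {X : VarietyGerm G} (p : X.ProjEquiv) (g : G) : g • p.1 = p.1 :=
  (X.exists_mem_equivariantFunctions_iff p.1).1 p.2 g

theorem isotropyRep_eq_choose (p : X.ProjEquiv) (g : G)
    (hg : g ∈ MulAction.stabilizer G p.1) : isotropyRep p.1 ⟨g, hg⟩ = p.2.choose g := by
  refine unit_smul_injective p.1.rep_nonzero ?_
  rw [← isotropyRep_spec p.1 ⟨g, hg⟩ p.1.rep_nonzero p.1.mk_rep]
  exact p.2.choose_spec g

/-! ### Cylindric sets -/

/-- Every jet has a lift with the same isotropy group, so that the empty set can only be defined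
by the empty set of jets. -/
theorem OrbitEuler.eq_zero [Finite G] {X : VarietyGerm G} {c : ℤ} (h : X.OrbitEuler ∅ c) :
    c = 0 := by
  obtain ⟨k, hk⟩ := h
  obtain ⟨Z, -, rfl, -, hZ⟩ := hk k le_rfl
  have : IsEmpty Z := ⟨fun z => by
    obtain ⟨z, hz⟩ := z
    induction z using Quotient.inductionOn' with | _ q
    obtain ⟨p, hp, hs⟩ := X.exists_projJet_eq k q
    exact (hZ p q hp hs).2 hz⟩
  exact eulerChar_of_isEmpty Z

theorem EquivEuler.empty : X.EquivEuler ∅ 0 :=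
  ⟨0, fun k _ => ⟨∅, isConstructibleSubset_empty _, eulerChar_of_isEmpty _,
    fun _ h => h.elim, by simp⟩⟩

/-- The set of jets in the definition of `EquivEuler` is determined by `B`, as each of
these jets is the jet of an equivariant function. -/
theorem EquivEuler.unique {X : VarietyGerm G} {B : Set X.ProjEquiv} {c c' : ℤ}
    (h : X.EquivEuler B c) (h' : X.EquivEuler B c') : c = c' := by
  obtain ⟨k, hk⟩ := h
  obtain ⟨k', hk'⟩ := h'
  obtain ⟨Z, -, hc, hl, hB⟩ := hk (max k k') (le_max_left _ _)
  obtain ⟨Z', -, hc', hl', hB'⟩ := hk' (max k k') (le_max_right _ _)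
  have key : ∀ {Y Y' : Set (ℙ ℂ (X.J (max k k')))},
      (∀ q ∈ Y, ∃ p : X.ProjEquiv, X.projJet (max k k') p.1 = some q) →
      B = {p | ∃ q ∈ Y, X.projJet (max k k') p.1 = some q} →
      B = {p | ∃ q ∈ Y', X.projJet (max k k') p.1 = some q} → Y ⊆ Y' := by
    intro Y Y' hl h h' q hq
    obtain ⟨p, hp⟩ := hl q hq
    have hpB : p ∈ B := by
      rw [h]
      exact ⟨q, hq, hp⟩
    rw [h'] at hpB
    obtain ⟨q', hq', hp'⟩ := hpB
    rw [hp, Option.some_inj] at hp'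
    rwa [hp']
  have hZ : Z = Z' := (key hl hB hB').antisymm (key hl' hB' hB)
  rw [← hc, ← hc', hZ]

/-- A cylindric set of one-point orbits is a cylindric set of equivariant functions, with the same
Euler characteristic: for large `k` the jets that define it have lifts with the same isotropy
group, so that they are fixed by `G` as well. -/
theorem OrbitEuler.equivEuler [Finite G] {X : VarietyGerm G} {B : Set X.ProjO} {c : ℤ}
    (h : X.OrbitEuler B c)
    (hB : ∀ p : ℙ ℂ X.O, (Quotient.mk'' p : X.ProjO) ∈ B → ∀ g : G, g • p = p) :
    X.EquivEuler {p | (Quotient.mk'' p.1 : X.ProjO) ∈ B} c := by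
  obtain ⟨k₀, hk⟩ := h
  refine ⟨k₀, fun k hk₀ => ?_⟩
  obtain ⟨Z, hZc, hZ, hnone, hiff⟩ := hk k hk₀
  have lift : ∀ q : ℙ ℂ (X.J k), (Quotient.mk'' q : X.ProjJ k) ∈ Z →
      ∃ p : ℙ ℂ X.O, X.projJet k p = some q ∧
        MulAction.stabilizer G p = MulAction.stabilizer G q ∧ ∀ g : G, g • p = p := by
    intro q hq
    obtain ⟨p, hp, hs⟩ := X.exists_projJet_eq k q
    exact ⟨p, hp, hs, hB p ((hiff p q hp hs).2 hq)⟩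
  have hfix : ∀ q : ℙ ℂ (X.J k), (Quotient.mk'' q : X.ProjJ k) ∈ Z → ∀ g : G, g • q = q := by
    intro q hq g
    obtain ⟨p, -, hs, hp⟩ := lift q hq
    have hg : g ∈ MulAction.stabilizer G p := hp g
    rwa [hs] at hg
  have hstab : ∀ (p : X.ProjEquiv) (q : ℙ ℂ (X.J k)), X.projJet k p.1 = some q →
      MulAction.stabilizer G p.1 = MulAction.stabilizer G q := fun p q hpq =>
    le_antisymm (X.stabilizer_le_of_projJet k hpq) fun g _ => p.smul_eq g
  refine ⟨_, hZc, (eulerChar_preimage_of_fixed Z hfix).trans hZ, fun q hq => ?_,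
    Set.ext fun p => ⟨fun hp => ?_, ?_⟩⟩
  · obtain ⟨p, hp, -, hpfix⟩ := lift q hq
    exact ⟨⟨p, (X.exists_mem_equivariantFunctions_iff p).2 hpfix⟩, hp⟩
  · obtain ⟨q, hq⟩ := Option.ne_none_iff_exists'.1 (hnone p.1 hp)
    exact ⟨q, (hiff p.1 q hq (hstab p q hq)).1 hp, hq⟩
  · rintro ⟨q, hq, hpq⟩
    exact (hiff p.1 q hpq (hstab p q hpq)).2 hq

/-! ### Comparison of the integrands -/

/-- The orbit of an equivariant function is a single point. -/
theorem T_of_fixed [Finite G] (p : X.ProjEquiv) :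
    X.T v (Quotient.mk'' p.1) = if ∀ i, v i p.1.rep ≠ ⊤ then
      (GRSet.point (fun i => (v i p.1.rep).toNat, p.2.choose)).cls else 0 := by
  classical
  let ω : X.ProjO := Quotient.mk'' p.1
  have horb : ∀ x ∈ ω.orbit, x = p.1 := by
    intro x hx
    obtain ⟨g, rfl⟩ := hx
    exact p.smul_eq g
  have hmem : p.1 ∈ ω.orbit := MulAction.mem_orbit_self p.1
  have hiff : (∀ x ∈ ω.orbit, ∀ i, v i x.rep ≠ ⊤) ↔ ∀ i, v i p.1.rep ≠ ⊤ :=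
    ⟨fun h => h _ hmem, fun h x hx => by rwa [horb x hx]⟩
  rw [T]
  refine if_ctx_congr hiff (fun _ => ?_) fun _ => rfl
  let x : (X.orbitSet v ω).carrier := ⟨p.1, hmem⟩
  have hx : ∀ g : G, g • x = x := fun g => Subtype.ext (p.smul_eq g)
  have hα : (X.orbitSet v ω).char x hx = p.2.choose :=
    MonoidHom.ext fun g => X.isotropyRep_eq_choose p g _
  have h := GRSet.isom_point (X.orbitSet v ω) x hx fun y => Subtype.ext (horb y.1 y.2)
  rw [hα] at h
  exact (GRSet.cls_eq_of_isom h).symm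

theorem fixedSeries_T [Finite G] (p : X.ProjEquiv) :
    fixedSeries (X.T v (Quotient.mk'' p.1)) = X.equivMonomial v p := by
  rw [T_of_fixed, equivMonomial]
  split_ifs
  · exact fixedSeries_point _
  · exact map_zero _

/-- The action on an orbit is transitive, so that an orbit with a fixed point is that point. -/
theorem fixedSeries_T_of_not_fixed [Finite G] (p : ℙ ℂ X.O) (hp : ¬ ∀ g : G, g • p = p) :
    fixedSeries (X.T v (Quotient.mk'' p)) = 0 := by
  rw [T]
  split_ifs
  · refine fixedSeries_eq_zero _ ?_
    rintro ⟨x, g, rfl⟩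
    by_contra! h
    -- A conjugate of `a` fixes `g • p`, so `a` fixes `p`.
    refine hp fun a => ?_
    have h' : (g * a * g⁻¹) • (g • p) = g • p := congrArg Subtype.val (h (g * a * g⁻¹))
    rwa [mul_smul, mul_smul, inv_smul_smul, smul_left_cancel_iff] at h'
  · exact map_zero _

theorem T_eq_point_iff [Finite G] (p : X.ProjEquiv) (q : (Fin r → ℕ) × (G →* ℂˣ)) :
    X.T v (Quotient.mk'' p.1) = (GRSet.point q).cls ↔
      X.equivMonomial v p = Series.monomial q.1 (R₁.of q.2) := by
  constructor
  · intro h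
    rw [← fixedSeries_T, h, fixedSeries_point]
  · intro h
    rw [T_of_fixed]
    rw [equivMonomial] at h
    split_ifs at h ⊢
    · exact congrArg (fun q => (GRSet.point q).cls) (Series.monomial_of_injective h)
    · exact absurd h.symm (Series.monomial_ne_zero q)

/-! ### Comparison of the integrals -/

theorem point_cls_ne_zero (q : (Fin r → ℕ) × (G →* ℂˣ)) : (GRSet.point q).cls ≠ 0 := fun h =>
  Series.monomial_ne_zero q (by rw [← fixedSeries_point, h, map_zero])

theorem IsEquivariantPoincareSeries.isEarlierPoincareSeries [Finite G] {X : VarietyGerm G}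
    {v : Fin r → X.O → ℕ∞} {P : K₀ G r} (h : X.IsEquivariantPoincareSeries v P) :
    X.IsEarlierPoincareSeries v (fixedSeries P) := by
  classical
  obtain ⟨c, hc, hsum⟩ := h
  -- Both sums are compared with a sum over the pairs `(w, α)`.
  let M : (Fin r → ℕ) × (G →* ℂˣ) → Series G r := fun q => Series.monomial q.1 (R₁.of q.2)
  let pt : (Fin r → ℕ) × (G →* ℂˣ) → {a : K₀ G r // a ≠ 0} := fun q =>
    ⟨(GRSet.point q).cls, point_cls_ne_zero q⟩
  let mo : (Fin r → ℕ) × (G →* ℂˣ) → {s : Series G r // s ≠ 0} := fun q =>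
    ⟨M q, Series.monomial_ne_zero q⟩
  have hmo : Function.Injective mo := fun q q' h =>
    Series.monomial_of_injective (congrArg Subtype.val h)
  have hpt : Function.Injective pt := fun q q' h => Series.monomial_of_injective <| by
    have h' := congrArg fixedSeries (congrArg Subtype.val h)
    exact (fixedSeries_point q).symm.trans (h'.trans (fixedSeries_point q'))
  have hs : HasSum (fun q => c (GRSet.point q).cls • M q) (fixedSeries P) := by
    have h1 := hsum.map (fixedSeries : K₀ G r →+* Series G r) continuous_fixedSeries
    rw [← hpt.hasSum_iff] at h1
    · refine (congrArg (HasSum · (fixedSeries P)) (funext fun q => ?_)).mp h1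
      change fixedSeries (c (GRSet.point q).cls • (GRSet.point q).cls) = _
      rw [map_zsmul, fixedSeries_point]
    · rintro ⟨a, ha⟩ hr
      change fixedSeries (c a • a) = 0
      rw [map_zsmul]
      by_cases hpre : X.T v ⁻¹' {a} = ∅
      · have hE := hc a ha
        rw [hpre] at hE
        rw [hE.eq_zero, zero_smul]
      obtain ⟨ω, rfl⟩ := Set.nonempty_iff_ne_empty.2 hpre
      induction ω using Quotient.inductionOn' with | _ p
      by_cases hp : ∀ g : G, g • p = p
      · have hT := X.T_of_fixed v ⟨p, (X.exists_mem_equivariantFunctions_iff p).2 hp⟩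
        split_ifs at hT
        · exact absurd ⟨_, Subtype.ext hT.symm⟩ hr
        · exact absurd hT ha
      · rw [X.fixedSeries_T_of_not_fixed v p hp, smul_zero]
  let c' : Series G r → ℤ := fun s =>
    if h : ∃ q, M q = s then c (GRSet.point h.choose).cls else 0
  have hc' : ∀ q, c' (M q) = c (GRSet.point q).cls := fun q => by
    have hq : ∃ q', M q' = M q := ⟨q, rfl⟩
    have hq' : hq.choose = q := Series.monomial_of_injective hq.choose_spec
    simp only [c', dif_pos hq, hq']
  refine ⟨c', fun s hs0 => ?_, ?_⟩
  · by_cases hM : ∃ q, M q = s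
    · obtain ⟨q, rfl⟩ := hM
      rw [hc']
      have hE := (hc _ (point_cls_ne_zero q)).equivEuler fun p hp => by
        by_contra hn
        have h0 := X.fixedSeries_T_of_not_fixed v p hn
        rw [show X.T v (Quotient.mk'' p) = (GRSet.point q).cls from hp, fixedSeries_point] at h0
        exact Series.monomial_ne_zero q h0
      exact (congrArg (X.EquivEuler · _) (Set.ext fun p => X.T_eq_point_iff v p q)).mp hE
    · have h0 : c' s = 0 := dif_neg hM
      have hempty : X.equivMonomial v ⁻¹' {s} = ∅ := by
        refine Set.eq_empty_of_forall_notMem fun p hp => ?_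
        have hp' : X.equivMonomial v p = s := hp
        rw [equivMonomial] at hp'
        split_ifs at hp'
        · exact hM ⟨(_, _), hp'⟩
        · exact hs0 hp'.symm
      rw [h0, hempty]
      exact EquivEuler.empty X
  · rw [← hmo.hasSum_iff]
    · refine (congrArg (HasSum · (fixedSeries P)) (funext fun q => ?_)).mp hs
      exact congrArg (· • M q) (hc' q).symm
    · rintro ⟨s, hs0⟩ hr
      have hM : ¬ ∃ q, M q = s := fun ⟨q, hq⟩ => hr ⟨q, Subtype.ext hq⟩
      have h0 : c' s = 0 := dif_neg hM
      change c' s • s = 0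
      rw [h0, zero_smul]

theorem IsEarlierPoincareSeries.unique {X : VarietyGerm G} {v : Fin r → X.O → ℕ∞}
    {Q Q' : Series G r} (h : X.IsEarlierPoincareSeries v Q) (h' : X.IsEarlierPoincareSeries v Q') :
    Q = Q' := by
  obtain ⟨c, hc, hs⟩ := h
  obtain ⟨c', hc', hs'⟩ := h'
  have hcc : (fun a : {a : Series G r // a ≠ 0} => c a.1 • a.1) = fun a => c' a.1 • a.1 :=
    funext fun a => congrArg (· • a.1) ((hc a.1 a.2).unique (hc' a.1 a.2))
  rw [hcc] at hs
  exact hs.unique hs'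

end VarietyGerm

end EquivPoincare

end

theorem mainTheorem4 {G : Type u} [Group G] [Finite G] (r : ℕ) :
    ∃ (Φ : EquivPoincare.K₀' G r ≃+* EquivPoincare.Series G r)
      (proj : EquivPoincare.K₀ G r →+* EquivPoincare.K₀' G r),
      -- `Φ` sends a `(G, r)`-set `A` with trivial action to the sum of `α_x t^{w(x)}` over `x ∈ A`
      (∀ (A : EquivPoincare.GRSet G r) (hA : ∀ (g : G) (x : A.carrier), g • x = x)
        (w : Fin r → ℕ) (g : G),
        (EquivPoincare.Series.coeff w (Φ ⟨A.cls, A.cls_mem hA⟩) : G → ℂ) g =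
          ∑ᶠ x : {x : A.carrier // A.w x = w}, (A.α x.1 ⟨g, hA g x.1⟩ : ℂ)) ∧
      -- `K₀` is the semidirect product of `K₀'` and `K₀''`, and `proj` is the projection
      IsCompl (EquivPoincare.K₀' G r).toAddSubgroup (EquivPoincare.K₀'' G r).toAddSubgroup ∧
      (∀ x, ∀ y ∈ EquivPoincare.K₀'' G r, x * y ∈ EquivPoincare.K₀'' G r) ∧
      (∀ x : EquivPoincare.K₀' G r, proj x = x) ∧
      (∀ y ∈ EquivPoincare.K₀'' G r, proj y = 0) ∧
      -- the earlier series is the image of the equivariant Poincaré series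
      ∀ (X : EquivPoincare.VarietyGerm G) (v : Fin r → X.O → ℕ∞),
        (∀ i, EquivPoincare.IsOrderFunction (v i)) → X.FinitelyDetermined v →
        ∀ P : EquivPoincare.K₀ G r, X.IsEquivariantPoincareSeries v P →
          ∀ Q : EquivPoincare.Series G r,
            X.IsEarlierPoincareSeries v Q ↔ Q = Φ (proj P) := by
  refine ⟨EquivPoincare.K₀'.equivSeries G r, EquivPoincare.K₀.proj G r,
    EquivPoincare.K₀'.coeff_equivSeries, EquivPoincare.K₀.isCompl G r,
    fun x _ hy => EquivPoincare.K₀''.mul_mem_left x hy, EquivPoincare.K₀.proj_coe,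
    fun _ hy => EquivPoincare.K₀.proj_of_mem_K₀'' hy, fun X v _ _ P hP Q => ?_⟩
  rw [EquivPoincare.K₀.equivSeries_proj]
  have h := hP.isEarlierPoincareSeries
  exact ⟨fun hQ => hQ.unique h, fun hQ => hQ ▸ h⟩
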